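/- Let $G$ be a group acting from the left on a non-empty set $S$. Let $C=\{0,1\}^{\mathbb N}$, let $C^S$ be the space of functions $S\to C$ with the product topology, and for $n\in\mathbb N$ let $C^S(n)$ be the disjoint union of $n$ copies of $C^S$. For a function $\psi\colon S\to\{0,1\}^*$ with $\psi(s)=\varnothing$ for all but finitely many $s$, the dyadic brick $B(\psi)$ is the set of all $\kappa\in C^S$ such that $\psi(s)$ is a prefix of $\kappa(s)$ for all $s\in S$, and the canonical homeomorphism $h_\psi\colon C^S\to B(\psi)$ is $h_\psi(\kappa)(s)=\psi(s)\cdot\kappa(s)$ (concatenation). The Brin–Thompson groupoid $S\mathcal V$ consists of all homeomorphisms $C^S(m)\to C^S(n)$, $m,n\in\mathbb N$, obtained by partitioning the domain and the range into the same finite number of dyadic bricks (in the copies of $C^S$), and mapping the $i$-th brick $B(\psi_i)$ of the domain to the $i$-th brick $B(\varphi_i)$ of the range by $h_{\varphi_i}\circ h_{\psi_i}^{-1}$. It contains, for $s\in S$, the simple split $x_s\colon C^S\to C^S(2)$, which maps $\{\kappa:\kappa(s)\text{ begins with }0\}$ to the first copy and $\{\kappa:\kappa(s)\text{ begins with }1\}$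 to the second copy by canonical homeomorphisms, and, for $\sigma\in\Sigma_n$, the permutation $p_\sigma$ of the copies in $C^S(n)$, which sends the $i$-th copy to the $\sigma(i)$-th copy. The abstract twisted Brin–Thompson groupoid $S\mathcal V_G$ is the groupoid with set of objects $\mathbb N$ generated by $S\mathcal V$ (an element $C^S(m)\to C^S(n)$ being a morphism $m\to n$) and by a copy of the group $G^n$ based at the object $n$ for each $n\in\mathbb N$, the element $(g_1,\dots,g_n)$ being written $g_1\oplus\cdots\oplus g_n$, subject to the relations (closed under compositions and direct sums) \[ x_{g.s}\circ g=(g\oplus g)\circ x_s \quad (s\in S,\ g\in G), \] \[ (g_1\oplus\cdots\oplus g_n)\circ p_\sigma=p_\sigma\circ(g_{\sigma(1)}\oplus\cdots\oplus g_{\sigma(n)}) \quad (n\in\mathbb N,\ \sigma\in\Sigma_n,\ g_1,\dots,g_n\in G). \] The abstract twisted Brin–Thompson group $SV_G$ is the group of all morphisms $1\to 1$ of $S\mathcal V_G$ under composition. Then $SV_G$ is $5$-uniformly perfect: every element of $SV_G$ is a product of $5$ commutators of elements of $SV_G$. -/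

import Mathlib

namespace BrinThompson

/-! ### Dyadic bricks in `C^S` -/

/-- Concatenation `l · x` of a finite binary word `l` with an infinite binary sequence `x`. -/
def prepend : List Bool → (ℕ → Bool) → ℕ → Bool
  | [], x => x
  | b :: l, x => fun n => match n with
    | 0 => b
    | k + 1 => prepend l x k

theorem prepend_injective (l : List Bool) : Function.Injective (prepend l) := by
  induction l with
  | nil => exact fun _ _ h => h
  | cons b l ih =>
    intro x y h
    exact ih (funext fun k => congrFun h (k + 1))

theorem continuous_prepend (l : List Bool) : Continuous (prepend l) := by
  induction l with
  | nil => exact continuous_id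
  | cons b l ih =>
    refine continuous_pi fun n => ?_
    cases n with
    | zero => exact continuous_const
    | succ k => exact (continuous_apply k).comp ih

/-- A function `ψ : S → {0,1}^*` that is the empty word at all but finitely many `s`. -/
structure Prefix (S : Type*) where
  word : S → List Bool
  finite : {s | word s ≠ []}.Finite

/-- The dyadic brick `B(ψ)`: all `κ ∈ C^S` such that `ψ s` is a prefix of `κ s` for all `s`. -/
def Prefix.brick {S : Type*} (ψ : Prefix S) : Set (S → ℕ → Bool) :=
  {κ | ∀ s, ∃ x : ℕ → Bool, κ s = prepend (ψ.word s) x}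

/-- The canonical homeomorphism `h_ψ : C^S → B(ψ)`, as a map into `C^S`. -/
def Prefix.canonical {S : Type*} (ψ : Prefix S) (κ : S → ℕ → Bool) : S → ℕ → Bool :=
  fun s => prepend (ψ.word s) (κ s)

theorem Prefix.mem_brick {S : Type*} (ψ : Prefix S) (κ : S → ℕ → Bool) :
    κ ∈ ψ.brick ↔ ∃ η, ψ.canonical η = κ := by
  constructor
  · intro h
    choose η hη using h
    exact ⟨η, funext fun s => (hη s).symm⟩
  · rintro ⟨η, rfl⟩ s
    exact ⟨η s, rfl⟩

theorem Prefix.canonical_injective {S : Type*} (ψ : Prefix S) :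
    Function.Injective ψ.canonical :=
  fun _ _ h => funext fun s => prepend_injective _ (congrFun h s)

theorem Prefix.continuous_canonical {S : Type*} (ψ : Prefix S) : Continuous ψ.canonical :=
  continuous_pi fun s => (continuous_prepend _).comp (continuous_apply s)

/-- The function that is the empty word everywhere. -/
def Prefix.empty (S : Type*) : Prefix S where
  word := fun _ => []
  finite := by simp

open Classical in
/-- The function sending `s` to the one-letter word `b` and everything else to the empty word. -/
noncomputable def Prefix.single {S : Type*} (s : S) (b : Bool) : Prefix S where
  word := fun t => if t = s then [b] else []
  finite := (Set.finite_singleton s).subset (by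
    intro t ht
    by_contra h
    exact ht (if_neg h))

theorem Prefix.mem_brick_empty {S : Type*} (κ : S → ℕ → Bool) : κ ∈ (Prefix.empty S).brick :=
  fun s => ⟨κ s, rfl⟩

theorem Prefix.mem_brick_single {S : Type*} (s : S) (b : Bool) (κ : S → ℕ → Bool) :
    κ ∈ (Prefix.single s b).brick ↔ κ s 0 = b := by
  constructor
  · intro h
    obtain ⟨x, hx⟩ := h s
    rw [hx]
    simp [Prefix.single, prepend]
  · intro h t
    by_cases ht : t = s
    · subst ht
      refine ⟨fun n => κ t (n + 1), funext fun n => ?_⟩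
      cases n with
      | zero => simp [Prefix.single, prepend, h]
      | succ k => simp [Prefix.single, prepend]
    · exact ⟨κ t, by simp [Prefix.single, prepend, ht]⟩

/-! ### The Brin-Thompson groupoid -/

/-- `C^S(n)`, the disjoint union of `n` copies of `C^S`. -/
abbrev Cube (S : Type*) (n : ℕ) : Type _ := Fin n × (S → ℕ → Bool)

/-- A partition of `C^S(m)` into `N` dyadic bricks, numbered by `Fin N`: the `a`-th one is the
dyadic brick `B(brick a)` in the copy of `C^S` with number `copy a`. -/
structure DyadicPartition (S : Type*) (m N : ℕ) where
  copy : Fin N → Fin m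
  brick : Fin N → Prefix S
  exists_unique : ∀ x : Cube S m, ∃! a, copy a = x.1 ∧ x.2 ∈ (brick a).brick

/-- The map `C^S(N) → C^S(m)` that sends the `a`-th copy of `C^S` onto the `a`-th brick of the
partition by the canonical homeomorphism. -/
def DyadicPartition.map {S : Type*} {m N : ℕ} (D : DyadicPartition S m N) (x : Cube S N) :
    Cube S m :=
  (D.copy x.1, (D.brick x.1).canonical x.2)

theorem DyadicPartition.bijective_map {S : Type*} {m N : ℕ} (D : DyadicPartition S m N) :
    Function.Bijective D.map := by
  constructor
  · rintro ⟨a, κ⟩ ⟨b, η⟩ h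
    have h1 : D.copy a = D.copy b := congrArg Prod.fst h
    have h2 : (D.brick a).canonical κ = (D.brick b).canonical η := congrArg Prod.snd h
    have hab : a = b := (D.exists_unique (D.map (a, κ))).unique
      ⟨rfl, ((D.brick a).mem_brick _).2 ⟨κ, rfl⟩⟩
      ⟨h1.symm, ((D.brick b).mem_brick _).2 ⟨η, h2.symm⟩⟩
    subst hab
    rw [(D.brick a).canonical_injective h2]
  · rintro ⟨j, κ⟩
    obtain ⟨a, ⟨h1, h2⟩, -⟩ := D.exists_unique (j, κ)
    obtain ⟨η, hη⟩ := ((D.brick a).mem_brick κ).1 h2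
    exact ⟨(a, η), Prod.ext h1 hη⟩

theorem DyadicPartition.continuous_map {S : Type*} {m N : ℕ} (D : DyadicPartition S m N) :
    Continuous D.map :=
  continuous_prod_of_discrete_left.2 fun a =>
    (continuous_const (y := D.copy a)).prodMk (D.brick a).continuous_canonical

/-- The map of a dyadic partition, as a homeomorphism `C^S(N) → C^S(m)`. -/
noncomputable def DyadicPartition.homeo {S : Type*} {m N : ℕ} (D : DyadicPartition S m N) :
    Cube S N ≃ₜ Cube S m :=
  Continuous.homeoOfEquivCompactToT2 (f := Equiv.ofBijective D.map D.bijective_map)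
    D.continuous_map

/-- The morphisms `C^S(m) → C^S(n)` of the Brin-Thompson groupoid: the homeomorphisms obtained by
partitioning the domain and the range into the same number of dyadic bricks and mapping the `a`-th
brick of the domain to the `a`-th brick of the range by the canonical homeomorphism. -/
def BTHom (S : Type*) (m n : ℕ) : Type _ :=
  {f : Cube S m ≃ₜ Cube S n //
    ∃ (N : ℕ) (D : DyadicPartition S m N) (R : DyadicPartition S n N),
      f = D.homeo.symm.trans R.homeo}

/-- The partition of `C^S(n)` into its `n` copies of `C^S`, numbered by means of `σ`. -/
def DyadicPartition.copies (S : Type*) {n : ℕ} (σ : Equiv.Perm (Fin n)) :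
    DyadicPartition S n n where
  copy := σ
  brick := fun _ => Prefix.empty S
  exists_unique := fun x => ⟨σ.symm x.1, ⟨σ.apply_symm_apply _, Prefix.mem_brick_empty _⟩,
    fun _ hb => σ.eq_symm_apply.2 hb.1⟩

theorem DyadicPartition.homeo_copies_one (S : Type*) (n : ℕ) :
    (DyadicPartition.copies S (1 : Equiv.Perm (Fin n))).homeo = Homeomorph.refl _ := by
  ext1 x
  rfl

/-- The permutation `p_σ`, which sends the `i`-th copy of `C^S` to the `σ i`-th one. -/
noncomputable def BTHom.perm (S : Type*) {n : ℕ} (σ : Equiv.Perm (Fin n)) : BTHom S n n :=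
  ⟨(DyadicPartition.copies S σ).homeo, n, DyadicPartition.copies S 1, DyadicPartition.copies S σ,
    by rw [DyadicPartition.homeo_copies_one]; rfl⟩

/-- The partition of `C^S(n)` that cuts the `k`-th copy of `C^S` into the two halves
`κ s 0 = false` and `κ s 0 = true`, in this order, and leaves the other copies as they are. Note
that `k.predAbove : Fin (n + 1) → Fin n` is the monotone surjection that takes the value `k`
twice. -/
noncomputable def DyadicPartition.split {S : Type*} {n : ℕ} (k : Fin n) (s : S) :
    DyadicPartition S n (n + 1) where
  copy := k.predAbove
  brick := fun a =>
    if a = k.castSucc then Prefix.single s false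
    else if a = k.succ then Prefix.single s true
    else Prefix.empty S
  exists_unique := by
    rintro ⟨j, κ⟩
    have hne : k.succ ≠ k.castSucc := (Fin.castSucc_lt_succ).ne'
    rcases lt_trichotomy j k with hj | rfl | hj
    · refine ⟨j.castSucc, ⟨?_, ?_⟩, ?_⟩
      · exact Fin.predAbove_castSucc_of_le k j hj.le
      · have h1 : j.castSucc ≠ k.castSucc := fun h => hj.ne (Fin.castSucc_injective _ h)
        have h2 : j.castSucc ≠ k.succ := by
          intro h; have := congrArg Fin.val h; have h3 : j.val < k.val := hj; simp at this; omega
        simp only [h1, h2, if_false]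
        exact Prefix.mem_brick_empty _
      · rintro b ⟨hb, -⟩
        have hb' := congrArg Fin.val hb
        have h3 : j.val < k.val := hj
        apply Fin.ext
        simp only [Fin.predAbove] at hb'
        split_ifs at hb' with h <;> simp [Fin.lt_def] at hb' h ⊢ <;> omega
    · cases hκ : κ s 0
      · refine ⟨j.castSucc, ⟨Fin.predAbove_castSucc_self j, ?_⟩, ?_⟩
        · simp [Prefix.mem_brick_single, hκ]
        · rintro b ⟨hb, hb2⟩
          by_contra hbj
          have hbs : b = j.succ := by
            have hb' := congrArg Fin.val hb
            have h4 : b.val ≠ j.val := fun h => hbj (Fin.ext h)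
            apply Fin.ext
            simp only [Fin.predAbove] at hb'
            split_ifs at hb' with h <;> simp [Fin.lt_def] at hb' h ⊢ <;> omega
          subst hbs
          simp [hne, Prefix.mem_brick_single, hκ] at hb2
      · refine ⟨j.succ, ⟨Fin.predAbove_succ_self j, ?_⟩, ?_⟩
        · simp [hne, Prefix.mem_brick_single, hκ]
        · rintro b ⟨hb, hb2⟩
          by_contra hbj
          have hbs : b = j.castSucc := by
            have hb' := congrArg Fin.val hb
            have h4 : b.val ≠ j.val + 1 := fun h => hbj (Fin.ext h)
            apply Fin.ext
            simp only [Fin.predAbove] at hb'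
            split_ifs at hb' with h <;> simp [Fin.lt_def] at hb' h ⊢ <;> omega
          subst hbs
          simp [Prefix.mem_brick_single, hκ] at hb2
    · refine ⟨j.succ, ⟨?_, ?_⟩, ?_⟩
      · exact Fin.predAbove_succ_of_le k j hj.le
      · have h1 : j.succ ≠ k.succ := fun h => hj.ne' (Fin.succ_injective _ h)
        have h2 : j.succ ≠ k.castSucc := by
          intro h; have := congrArg Fin.val h; have h3 : k.val < j.val := hj; simp at this; omega
        simp only [h1, h2, if_false]
        exact Prefix.mem_brick_empty _
      · rintro b ⟨hb, -⟩
        have hb' := congrArg Fin.val hb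
        have h3 : k.val < j.val := hj
        apply Fin.ext
        simp only [Fin.predAbove] at hb'
        split_ifs at hb' with h <;> simp [Fin.lt_def] at hb' h ⊢ <;> omega

/-- The direct sum `1 ⊕ ⋯ ⊕ x_s ⊕ ⋯ ⊕ 1 : C^S(n) → C^S(n + 1)` of a simple split `x_s` in the
`k`-th place and identities elsewhere. For `n = 1` it is the simple split `x_s`. -/
noncomputable def BTHom.split {S : Type*} {n : ℕ} (k : Fin n) (s : S) : BTHom S n (n + 1) :=
  ⟨(DyadicPartition.split k s).homeo.symm, n + 1, DyadicPartition.split k s,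
    DyadicPartition.copies S 1, by rw [DyadicPartition.homeo_copies_one]; rfl⟩

/-! ### The abstract twisted Brin-Thompson groupoid, by generators and relations -/

/-- Formal groupoid words from `C^S(m)` to `C^S(n)` in the morphisms of the Brin-Thompson groupoid
and in the elements `(g_1, …, g_n)` of a copy of `G^n` based at each object `n`. The word
`comp w v` stands for `w ∘ v`. -/
inductive Word (G : Type*) (S : Type*) : ℕ → ℕ → Type _
  | bt {m n : ℕ} (h : BTHom S m n) : Word G S m n
  | label {n : ℕ} (g : Fin n → G) : Word G S n n
  | id (n : ℕ) : Word G S n n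
  | comp {m n p : ℕ} (w : Word G S n p) (v : Word G S m n) : Word G S m p
  | inv {m n : ℕ} (w : Word G S m n) : Word G S n m

/-- The relations of the abstract twisted Brin-Thompson groupoid of an action of `G` on `S`. -/
inductive Rel {G : Type*} {S : Type*} [Group G] [MulAction G S] :
    ∀ {m n : ℕ}, Word G S m n → Word G S m n → Prop
  -- The relation is an equivalence relation compatible with the operations.
  | refl {m n : ℕ} (w : Word G S m n) : Rel w w
  | symm {m n : ℕ} {w v : Word G S m n} : Rel w v → Rel v w
  | trans {m n : ℕ} {w v u : Word G S m n} : Rel w v → Rel v u → Rel w u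
  | comp_congr {m n p : ℕ} {w w' : Word G S n p} {v v' : Word G S m n} :
      Rel w w' → Rel v v' → Rel (w.comp v) (w'.comp v')
  | inv_congr {m n : ℕ} {w w' : Word G S m n} : Rel w w' → Rel w.inv w'.inv
  -- The laws of a groupoid.
  | assoc {m n p q : ℕ} (w : Word G S p q) (v : Word G S n p) (u : Word G S m n) :
      Rel ((w.comp v).comp u) (w.comp (v.comp u))
  | id_comp {m n : ℕ} (w : Word G S m n) : Rel ((Word.id n).comp w) w
  | comp_id {m n : ℕ} (w : Word G S m n) : Rel (w.comp (Word.id m)) w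
  | inv_comp {m n : ℕ} (w : Word G S m n) : Rel (w.inv.comp w) (Word.id m)
  | comp_inv {m n : ℕ} (w : Word G S m n) : Rel (w.comp w.inv) (Word.id n)
  -- Composition in the Brin-Thompson groupoid and multiplication in `G^n`.
  | bt_comp {m n p : ℕ} (h : BTHom S n p) (h' : BTHom S m n) (h'' : BTHom S m p) :
      h''.1 = h'.1.trans h.1 → Rel ((Word.bt h).comp (Word.bt h')) (Word.bt h'')
  | label_comp {n : ℕ} (g g' : Fin n → G) :
      Rel ((Word.label g).comp (Word.label g')) (Word.label (g * g'))
  -- The relation `x_{g.s} ∘ g = (g ⊕ g) ∘ x_s` in the `k`-th place, with further labels in the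
  -- other places, that is, all its direct sums with identities and labels:
  -- `(1 ⊕ x_{g_k.s} ⊕ 1) ∘ (g_1, …, g_n) = (g_1, …, g_k, g_k, …, g_n) ∘ (1 ⊕ x_s ⊕ 1)`.
  | split {n : ℕ} (g : Fin n → G) (k : Fin n) (s : S) :
      Rel ((Word.bt (BTHom.split k (g k • s))).comp (Word.label g))
        ((Word.label (g ∘ k.predAbove)).comp (Word.bt (BTHom.split k s)))
  -- The relation `(g_1, …, g_n) ∘ p_σ = p_σ ∘ (g_{σ(1)}, …, g_{σ(n)})`.
  | perm {n : ℕ} (g : Fin n → G) (σ : Equiv.Perm (Fin n)) :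
      Rel ((Word.label g).comp (Word.bt (BTHom.perm S σ)))
        ((Word.bt (BTHom.perm S σ)).comp (Word.label (g ∘ σ)))

/-- The equivalence relation on words given by the relations. -/
def wordSetoid (G S : Type*) [Group G] [MulAction G S] (m n : ℕ) : Setoid (Word G S m n) where
  r := Rel
  iseqv := ⟨Rel.refl, Rel.symm, Rel.trans⟩

/-- The morphisms `m → n` of the abstract twisted Brin-Thompson groupoid of `G` acting on `S`. -/
def TwistedHom (G S : Type*) [Group G] [MulAction G S] (m n : ℕ) : Type _ :=
  Quotient (wordSetoid G S m n)

/-- The abstract twisted Brin-Thompson group `SV_G`: the elements of the groupoid with rank and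
corank `1`. -/
abbrev SV (G S : Type*) [Group G] [MulAction G S] : Type _ := TwistedHom G S 1 1

/-- The group operation is composition. -/
instance (G S : Type*) [Group G] [MulAction G S] (n : ℕ) : Group (TwistedHom G S n n) where
  mul := Quotient.map₂ Word.comp fun _ _ h _ _ h' => Rel.comp_congr h h'
  one := Quotient.mk _ (Word.id n)
  inv := Quotient.map Word.inv fun _ _ h => Rel.inv_congr h
  mul_assoc := by
    rintro ⟨a⟩ ⟨b⟩ ⟨c⟩
    exact Quotient.sound (Rel.assoc a b c)
  one_mul := by
    rintro ⟨a⟩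
    exact Quotient.sound (Rel.id_comp a)
  mul_one := by
    rintro ⟨a⟩
    exact Quotient.sound (Rel.comp_id a)
  inv_mul_cancel := by
    rintro ⟨a⟩
    exact Quotient.sound (Rel.inv_comp a)

/-- A group is `n`-uniformly perfect if every element is a product of `n` commutators
`a * b * a⁻¹ * b⁻¹`. -/
def IsUniformlyPerfect (n : ℕ) (H : Type*) [Group H] : Prop :=
  ∀ h : H, ∃ a b : Fin n → H, h = (List.ofFn fun i => a i * b i * (a i)⁻¹ * (b i)⁻¹).prod

end BrinThompson

open Filter Topology
open scoped commutatorElement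

namespace BrinThompson

/-! ### Finite prefixes and dyadic bricks -/

/-! The abstract group is first made concrete. The groupoid acts on the points of the copies of
`C^S` with an additional coordinate in `G`, which labels multiply from the left; this coordinate
keeps the action faithful even if `G` does not act faithfully on `S`. Faithfulness
(`TwistedHom.eq_id_of_eval_eq`) rests on the normal form "cut, label, glue"
(`TwistedHom.exists_normal_form`): the defining relations push labels through iterated splits, and
any two partitions have a common refinement that arises from both by such splits. By compactness,
the image of the group consists of all permutations that locally map bricks to bricks by a label
(`IsLocal.mem_range`). This makes swaps of bricks and copies of an element inside a brick available.

The group is perfect (`LocalPerm.map_eq_one`) because of self-similarity. A swap of two bricks is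
the product of the swaps of their halves; when there is room, all three are conjugate, so under a
homomorphism to a commutative group the value equals its own square and is trivial. The same
argument kills changes of the direction of a split and labels, and these elements together with
swaps account for everything.

Few commutators suffice because of displacement. An element `t` all of whose positive powers move
one half of the space into the other turns any product of commutators of elements supported in the
first half into a product of two commutators (`exists_eq_commutator_mul_commutator`). By perfectness
and conjugation, two commutators give every element that fixes a suitable brick pointwise. An
element that moves a point of `C^S` agrees with a single commutator on a small brick, so it needs
three; any other element moves a point after multiplication by one commutator, so it needs four. -/

theorem prepend_append (l m : List Bool) (x : ℕ → Bool) :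
    prepend (l ++ m) x = prepend l (prepend m x) := by
  induction l with
  | nil => rfl
  | cons b l ih =>
    funext k
    cases k with
    | zero => rfl
    | succ k => exact congrFun ih k

/-- Two finite words that are prefixes of the same sequence have a common extension. -/
theorem exists_common_extension (l m : List Bool) {x y : ℕ → Bool}
    (h : prepend l x = prepend m y) :
    ∃ (a b : List Bool) (z : ℕ → Bool), l ++ a = m ++ b ∧ x = prepend a z ∧ y = prepend b z ∧
      (l.length ≤ m.length → b = []) ∧ (m.length ≤ l.length → a = []) := by
  induction l generalizing m with
  | nil => exact ⟨m, [], y, by simp, h, rfl, by simp, by simp⟩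
  | cons c l ih =>
    cases m with
    | nil => exact ⟨[], c :: l, x, by simp, rfl, h.symm, by simp, by simp⟩
    | cons d m =>
      obtain ⟨a, b, z, h1, h2, h3, h4, h5⟩ := ih m (funext fun k => congrFun h (k + 1))
      have hcd : c = d := congrFun h 0
      exact ⟨a, b, z, by simp [hcd, h1], h2, h3, by simpa using h4, by simpa using h5⟩

theorem exists_prepend_of_agree (x : ℕ → Bool) (n : ℕ) :
    ∃ (l : List Bool) (y : ℕ → Bool), l.length = n ∧ x = prepend l y ∧
      ∀ z i, i < n → prepend l z i = x i := by
  induction n generalizing x with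
  | zero => exact ⟨[], x, rfl, rfl, by simp⟩
  | succ n ih =>
    obtain ⟨l, y, h1, h2, h3⟩ := ih fun k => x (k + 1)
    refine ⟨x 0 :: l, y, by simp [h1], ?_, ?_⟩
    · funext k
      cases k with
      | zero => rfl
      | succ k => exact congrFun h2 k
    · intro z i hi
      cases i with
      | zero => rfl
      | succ i => exact h3 z i (by omega)

theorem prepend_apply_of_lt (l : List Bool) (x y : ℕ → Bool) {i : ℕ} (hi : i < l.length) :
    prepend l x i = prepend l y i := by
  induction l generalizing i with
  | nil => simp at hi
  | cons b l ih =>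
    cases i with
    | zero => rfl
    | succ i => exact ih (by simpa using hi)

theorem exists_eq_prepend_of_agree (l : List Bool) (x y : ℕ → Bool)
    (h : ∀ i < l.length, y i = prepend l x i) : ∃ z, y = prepend l z := by
  induction l generalizing y with
  | nil => exact ⟨y, rfl⟩
  | cons b l ih =>
    obtain ⟨z, hz⟩ := ih (fun k => y (k + 1)) fun i hi => h (i + 1) (by simpa using hi)
    refine ⟨z, funext fun k => ?_⟩
    cases k with
    | zero => exact h 0 (by simp)
    | succ k => exact congrFun hz k

namespace Prefix

variable {S : Type*}

@[ext]
theorem ext_word {ψ φ : Prefix S} (h : ∀ s, ψ.word s = φ.word s) : ψ = φ := by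
  cases ψ
  cases φ
  congr
  exact funext h

/-- Concatenation of the words of two prefixes. -/
def append (ψ φ : Prefix S) : Prefix S where
  word s := ψ.word s ++ φ.word s
  finite := (ψ.finite.union φ.finite).subset fun s hs => by
    by_contra h
    simp_all

@[simp]
theorem word_append (ψ φ : Prefix S) (s : S) :
    (ψ.append φ).word s = ψ.word s ++ φ.word s := rfl

@[simp]
theorem word_empty (s : S) : (empty S).word s = [] := rfl

theorem canonical_append (ψ φ : Prefix S) (κ : S → ℕ → Bool) :
    (ψ.append φ).canonical κ = ψ.canonical (φ.canonical κ) :=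
  funext fun _ => prepend_append _ _ _

@[simp]
theorem canonical_empty (κ : S → ℕ → Bool) : (empty S).canonical κ = κ := rfl

@[simp]
theorem append_empty (ψ : Prefix S) : ψ.append (empty S) = ψ := by
  ext1 s
  simp

@[simp]
theorem empty_append (ψ : Prefix S) : (empty S).append ψ = ψ := by
  ext1 s
  simp

theorem append_assoc (ψ φ χ : Prefix S) : (ψ.append φ).append χ = ψ.append (φ.append χ) := by
  ext1 s
  simp

theorem canonical_mem_brick (ψ : Prefix S) (κ : S → ℕ → Bool) : ψ.canonical κ ∈ ψ.brick :=
  (ψ.mem_brick _).2 ⟨κ, rfl⟩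

/-- Two dyadic bricks with a common point have a common subbrick around it. -/
theorem exists_common_append (ψ φ : Prefix S) {κ η : S → ℕ → Bool}
    (h : ψ.canonical κ = φ.canonical η) :
    ∃ (α β : Prefix S) (ζ : S → ℕ → Bool), ψ.append α = φ.append β ∧ κ = α.canonical ζ ∧
      η = β.canonical ζ ∧ ((∀ s, (ψ.word s).length ≤ (φ.word s).length) → β = empty S) := by
  choose a b z h1 h2 h3 h4 h5 using fun s =>
    exists_common_extension (ψ.word s) (φ.word s) (congrFun h s)
  have hfin := ψ.finite.union φ.finite
  refine ⟨⟨a, hfin.subset fun s hs => ?_⟩, ⟨b, hfin.subset fun s hs => ?_⟩, z, ?_,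
    funext h2, funext h3, fun hl => ?_⟩
  · by_contra hn
    simp only [Set.mem_union, Set.mem_ofPred_eq, not_or, not_not] at hn
    exact hs (h5 s (by simp [hn.1, hn.2]))
  · by_contra hn
    simp only [Set.mem_union, Set.mem_ofPred_eq, not_or, not_not] at hn
    exact hs (h4 s (by simp [hn.1, hn.2]))
  · ext1 s
    exact h1 s
  · ext1 s
    exact h4 s (hl s)

/-- Every neighbourhood of a point contains a dyadic brick around it. -/
theorem exists_brick_subset {κ : S → ℕ → Bool} {U : Set (S → ℕ → Bool)} (hU : U ∈ 𝓝 κ) :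
    ∃ (ψ : Prefix S) (η : S → ℕ → Bool), κ = ψ.canonical η ∧ ∀ ζ, ψ.canonical ζ ∈ U := by
  classical
  rw [nhds_pi, Filter.mem_pi] at hU
  obtain ⟨I, hI, t, ht, hU⟩ := hU
  -- A neighbourhood in one factor `ℕ → Bool` restricts only finitely many digits, so it contains
  -- all sequences that agree with `κ s` long enough.
  have key : ∀ s, ∃ n, ∀ y : ℕ → Bool, (∀ i < n, y i = κ s i) → y ∈ t s := by
    intro s
    have h := ht s
    rw [nhds_pi, Filter.mem_pi] at h
    obtain ⟨J, hJ, u, hu, hsub⟩ := h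
    obtain ⟨n, hn⟩ := hJ.bddAbove
    refine ⟨n + 1, fun y hy => hsub fun i hi => ?_⟩
    rw [hy i (Nat.lt_succ_of_le (hn hi))]
    exact mem_of_mem_nhds (hu i)
  choose n hn using key
  choose l y h1 h2 h3 using fun s => exists_prepend_of_agree (κ s) (n s)
  refine ⟨⟨fun s => if s ∈ I then l s else [], hI.subset fun s hs => ?_⟩,
    fun s => if s ∈ I then y s else κ s, funext fun s => ?_, fun ζ => hU fun s hs => ?_⟩
  · by_contra hn
    simp [hn] at hs
  · by_cases hs : s ∈ I
    · simpa [canonical, hs] using h2 s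
    · simp [canonical, hs, prepend]
  · refine hn s _ fun i hi => ?_
    simpa [canonical, hs] using h3 s (ζ s) i hi

/-- Membership is a condition on finitely many digits at finitely many `s`. -/
theorem isOpen_brick (ψ : Prefix S) : IsOpen ψ.brick := by
  have : ψ.brick = ⋂ s ∈ {s | ψ.word s ≠ []}, ⋂ i ∈ Set.Iio (ψ.word s).length,
      {κ : S → ℕ → Bool | κ s i = prepend (ψ.word s) (fun _ => false) i} := by
    ext κ
    simp only [Set.mem_iInter, Set.mem_ofPred_eq, Set.mem_Iio]
    constructor
    · intro h s _ i hi
      obtain ⟨x, hx⟩ := h s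
      rw [hx]
      exact prepend_apply_of_lt _ _ _ hi
    · intro h s
      by_cases hs : ψ.word s = []
      · exact ⟨κ s, by rw [hs]; rfl⟩
      · exact exists_eq_prepend_of_agree _ _ _ (h s hs)
  rw [this]
  refine ψ.finite.isOpen_biInter fun s _ => (Set.finite_Iio _).isOpen_biInter fun i _ => ?_
  have h : Continuous fun κ : S → ℕ → Bool => κ s i :=
    (continuous_apply i).comp (continuous_apply s)
  exact (isOpen_discrete {prepend (ψ.word s) (fun _ => false) i}).preimage h

theorem brick_eq_range (ψ : Prefix S) : ψ.brick = Set.range ψ.canonical :=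
  Set.ext fun κ => ψ.mem_brick κ

/-- Needed for extending permutations of a brick by the identity: a point outside has a whole
neighbourhood outside, so the extension is local there. -/
theorem isClosed_brick (ψ : Prefix S) : IsClosed ψ.brick := by
  rw [brick_eq_range]
  exact (isCompact_range ψ.continuous_canonical).isClosed

/-- The words of `ψ` have length at most `d` and are empty outside `F`. -/
def Bounded (ψ : Prefix S) (F : Finset S) (d : ℕ) : Prop :=
  (∀ s, (ψ.word s).length ≤ d) ∧ ∀ s ∉ F, ψ.word s = []

/-- The words of `ψ` have length `d` on `F` and are empty outside `F`. -/
def Exact (ψ : Prefix S) (F : Finset S) (d : ℕ) : Prop :=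
  (∀ s ∈ F, (ψ.word s).length = d) ∧ ∀ s ∉ F, ψ.word s = []

theorem Exact.bounded {ψ : Prefix S} {F : Finset S} {d : ℕ} (h : ψ.Exact F d) :
    ψ.Bounded F d := by
  refine ⟨fun s => ?_, h.2⟩
  by_cases hs : s ∈ F
  · exact (h.1 s hs).le
  · simp [h.2 s hs]

theorem Bounded.mono {ψ : Prefix S} {F F' : Finset S} {d d' : ℕ}
    (h : ψ.Bounded F d) (hF : F ⊆ F') (hd : d ≤ d') : ψ.Bounded F' d' :=
  ⟨fun s => (h.1 s).trans hd, fun s hs => h.2 s fun hs' => hs (hF hs')⟩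

theorem exists_bounded (ψ : Prefix S) : ∃ F d, ψ.Bounded F d := by
  classical
  refine ⟨ψ.finite.toFinset, ∑ s ∈ ψ.finite.toFinset, (ψ.word s).length, fun s => ?_,
    fun s hs => by simpa using hs⟩
  by_cases hs : s ∈ ψ.finite.toFinset
  · exact Finset.single_le_sum (f := fun s => (ψ.word s).length) (fun _ _ => Nat.zero_le _) hs
  · have : ψ.word s = [] := by simpa using hs
    simp [this]

/-- An exact brick is contained in every bounded brick that it meets. -/
theorem Bounded.exists_append_eq {ψ φ : Prefix S} {F : Finset S} {d : ℕ} (hψ : ψ.Bounded F d)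
    (hφ : φ.Exact F d) {κ η : S → ℕ → Bool} (h : ψ.canonical κ = φ.canonical η) :
    ∃ α, ψ.append α = φ := by
  obtain ⟨α, β, -, h1, -, -, h2⟩ := exists_common_append ψ φ h
  refine ⟨α, ?_⟩
  rw [h1, h2, append_empty]
  intro s
  by_cases hs : s ∈ F
  · rw [hφ.1 s hs]
    exact hψ.1 s
  · simp [hψ.2 s hs]

/-- One prefix extends the other, and equal lengths leave no letters for the extension. -/
theorem Exact.eq_of_canonical_eq {ψ φ : Prefix S} {F : Finset S} {d : ℕ} (hψ : ψ.Exact F d)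
    (hφ : φ.Exact F d) {κ η : S → ℕ → Bool} (h : ψ.canonical κ = φ.canonical η) : ψ = φ := by
  obtain ⟨α, hα⟩ := hψ.bounded.exists_append_eq hφ h
  ext1 s
  rw [← hα]
  by_cases hs : s ∈ F
  · have h1 := congrArg (fun χ : Prefix S => (χ.word s).length) hα
    simp only [word_append, List.length_append, hψ.1 s hs, hφ.1 s hs] at h1
    have : α.word s = [] := List.eq_nil_of_length_eq_zero (by omega)
    simp [this]
  · have h1 := congrArg (fun χ : Prefix S => χ.word s) hα
    simp only [word_append, hφ.2 s hs, hψ.2 s hs, List.nil_append] at h1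
    simp [h1]

end Prefix

/-! ### Composition and refinement of dyadic partitions -/

namespace DyadicPartition

variable {S : Type*} {m n N P Q : ℕ}

@[ext]
theorem ext_data {D R : DyadicPartition S m N} (h : ∀ a, D.copy a = R.copy a)
    (h' : ∀ a, D.brick a = R.brick a) : D = R := by
  cases D
  cases R
  congr
  · exact funext h
  · exact funext h'

theorem exists_map_eq_of_mem (D : DyadicPartition S m N) (x : Cube S m) :
    ∃ a κ, D.map (a, κ) = x := by
  obtain ⟨⟨a, κ⟩, h⟩ := D.bijective_map.2 x
  exact ⟨a, κ, h⟩

theorem homeo_apply (D : DyadicPartition S m N) (x : Cube S N) : D.homeo x = D.map x := rfl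

theorem homeo_symm_map (D : DyadicPartition S m N) (x : Cube S N) :
    D.homeo.symm (D.map x) = x := D.homeo.symm_apply_apply x

/-- The partition given by the copies and bricks of a bijective map. -/
def ofBijective (copy : Fin N → Fin m) (brick : Fin N → Prefix S)
    (h : Function.Bijective
      fun x : Cube S N => ((copy x.1, (brick x.1).canonical x.2) : Cube S m)) :
    DyadicPartition S m N where
  copy := copy
  brick := brick
  exists_unique := by
    rintro ⟨j, κ⟩
    obtain ⟨⟨a, η⟩, ha⟩ := h.2 (j, κ)
    simp only [Prod.mk.injEq] at ha
    refine ⟨a, ⟨ha.1, ha.2 ▸ Prefix.canonical_mem_brick _ _⟩, ?_⟩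
    rintro b ⟨hb1, hb2⟩
    obtain ⟨ζ, hζ⟩ := (Prefix.mem_brick _ _).1 hb2
    have := @h.1 (b, ζ) (a, η) (by simp_all)
    exact congrArg Prod.fst this

/-- Subdivide every brick of `D` according to a partition of the disjoint union of the bricks. -/
def comp (D : DyadicPartition S m N) (E : DyadicPartition S N P) : DyadicPartition S m P :=
  ofBijective (fun a => D.copy (E.copy a))
    (fun a => (D.brick (E.copy a)).append (E.brick a)) (by
      have := D.bijective_map.comp E.bijective_map
      convert this using 2 with x
      simp [map, Prefix.canonical_append])

@[simp]
theorem copy_comp (D : DyadicPartition S m N) (E : DyadicPartition S N P) (a : Fin P) :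
    (D.comp E).copy a = D.copy (E.copy a) := rfl

@[simp]
theorem brick_comp (D : DyadicPartition S m N) (E : DyadicPartition S N P) (a : Fin P) :
    (D.comp E).brick a = (D.brick (E.copy a)).append (E.brick a) := rfl

theorem map_comp (D : DyadicPartition S m N) (E : DyadicPartition S N P) (x : Cube S P) :
    (D.comp E).map x = D.map (E.map x) := by
  simp [map, Prefix.canonical_append]

theorem comp_assoc (D : DyadicPartition S m N) (E : DyadicPartition S N P)
    (K : DyadicPartition S P Q) : (D.comp E).comp K = D.comp (E.comp K) := by
  ext1 a
  · rfl
  · exact Prefix.append_assoc _ _ _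

@[simp]
theorem copy_copies (σ : Equiv.Perm (Fin n)) (a : Fin n) : (copies S σ).copy a = σ a := rfl

@[simp]
theorem brick_copies (σ : Equiv.Perm (Fin n)) (a : Fin n) :
    (copies S σ).brick a = Prefix.empty S := rfl

@[simp]
theorem comp_copies_one (D : DyadicPartition S m N) : D.comp (copies S 1) = D := by
  ext1 a <;> simp

@[simp]
theorem copies_one_comp (D : DyadicPartition S m N) : (copies S 1).comp D = D := by
  ext1 a <;> simp

theorem copies_comp_copies (σ τ : Equiv.Perm (Fin n)) :
    (copies S σ).comp (copies S τ) = copies S (σ * τ) := by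
  ext1 a <;> simp

@[simp]
theorem copy_split (k : Fin n) (s : S) (a : Fin (n + 1)) :
    (split k s).copy a = k.predAbove a := rfl

theorem brick_split (k : Fin n) (s : S) (a : Fin (n + 1)) :
    (split k s).brick a = if a = k.castSucc then Prefix.single s false
      else if a = k.succ then Prefix.single s true else Prefix.empty S := rfl

@[simp]
theorem brick_split_castSucc (k : Fin n) (s : S) :
    (split k s).brick k.castSucc = Prefix.single s false := by simp [brick_split]

@[simp]
theorem brick_split_succ (k : Fin n) (s : S) :
    (split k s).brick k.succ = Prefix.single s true := by
  simp [brick_split, (Fin.castSucc_lt_succ (i := k)).ne']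

/-- A piece of a split is one of the two halves or an untouched copy. -/
theorem split_cases (k : Fin n) (a : Fin (n + 1)) :
    a = k.castSucc ∨ a = k.succ ∨
      k.predAbove a ≠ k ∧ ∀ s : S, (split k s).brick a = Prefix.empty S := by
  by_cases h1 : a = k.castSucc
  · exact .inl h1
  by_cases h2 : a = k.succ
  · exact .inr (.inl h2)
  refine .inr (.inr ⟨fun h => ?_, fun s => by simp [brick_split, h1, h2]⟩)
  have h' := congrArg Fin.val h
  have h3 : a.val ≠ k.val := fun h => h1 (Fin.ext h)
  have h4 : a.val ≠ k.val + 1 := fun h => h2 (Fin.ext h)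
  simp only [Fin.predAbove] at h'
  split_ifs at h' with h <;> simp [Fin.lt_def] at h' h <;> omega

/-- Partitions obtained by iterated simple splits and permutations. -/
inductive IsForest : ∀ {N : ℕ}, DyadicPartition S m N → Prop
  | one : IsForest (copies S (1 : Equiv.Perm (Fin m)))
  | split {N : ℕ} {D : DyadicPartition S m N} (k : Fin N) (s : S) :
      IsForest D → IsForest (D.comp (split k s))
  | perm {N : ℕ} {D : DyadicPartition S m N} (σ : Equiv.Perm (Fin N)) :
      IsForest D → IsForest (D.comp (copies S σ))

theorem IsForest.comp {D : DyadicPartition S m N} (hD : D.IsForest)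
    {E : DyadicPartition S N P} (hE : E.IsForest) : (D.comp E).IsForest := by
  induction hE with
  | one => simpa
  | split k s _ ih => simpa only [← comp_assoc] using ih.split k s
  | perm σ _ ih => simpa only [← comp_assoc] using ih.perm σ

/-- All bricks of `D` are bounded by `F` and `d`. -/
def Bounded (D : DyadicPartition S m N) (F : Finset S) (d : ℕ) : Prop :=
  ∀ a, (D.brick a).Bounded F d

/-- All bricks of `D` have words of length `d` exactly on `F`. -/
def Exact (D : DyadicPartition S m N) (F : Finset S) (d : ℕ) : Prop :=
  ∀ a, (D.brick a).Exact F d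

theorem exists_bounded (D : DyadicPartition S m N) : ∃ F d, D.Bounded F d := by
  classical
  choose F d h using fun a => (D.brick a).exists_bounded
  exact ⟨Finset.univ.biUnion F, ∑ a, d a, fun a => (h a).mono
    (Finset.subset_biUnion_of_mem F (Finset.mem_univ a))
    (Finset.single_le_sum (f := d) (fun _ _ => Nat.zero_le _) (Finset.mem_univ a))⟩

/-- Every partition that is bounded by `F` and `d` can be split to an exact one. -/
theorem Bounded.exists_isForest {D : DyadicPartition S m N} {F : Finset S} {d : ℕ}
    (hD : D.Bounded F d) :
    ∃ (P : ℕ) (U : DyadicPartition S N P), U.IsForest ∧ (D.comp U).Exact F d := by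
  classical
  -- A brick that lacks `r` letters in total needs `2 ^ r - 1` splits. Splitting it leaves two
  -- bricks that need `2 ^ (r - 1) - 1` each, so the sum drops by exactly one.
  let μ (ψ : Prefix S) : ℕ := 2 ^ (∑ s ∈ F, (d - (ψ.word s).length)) - 1
  induction h : ∑ a, μ (D.brick a) using Nat.strong_induction_on generalizing N with
  | _ r ih =>
  by_cases hex : D.Exact F d
  · exact ⟨N, copies S 1, .one, by simpa⟩
  simp only [Exact, Prefix.Exact, not_forall, not_and_or] at hex
  obtain ⟨k, ⟨s, hs, hk⟩ | ⟨s, hs, hk⟩⟩ := hex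
  swap
  · exact absurd ((hD k).2 s hs) hk
  have hlt : (((D.brick k).word s).length) < d := lt_of_le_of_ne ((hD k).1 s) hk
  have hlen (b : Bool) (t : S) : (((D.brick k).append (Prefix.single s b)).word t).length =
      ((D.brick k).word t).length + if t = s then 1 else 0 := by
    simp only [Prefix.word_append, Prefix.single, List.length_append]
    split_ifs <;> simp
  have hμ (b : Bool) : (2 : ℕ) * (μ ((D.brick k).append (Prefix.single s b)) + 1) =
      μ (D.brick k) + 1 := by
    have h1 : ∑ t ∈ F, (d - ((D.brick k).word t).length) =
        ∑ t ∈ F, (d - (((D.brick k).append (Prefix.single s b)).word t).length) + 1 := by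
      have h2 : (1 : ℕ) = ∑ t ∈ F, if t = s then 1 else 0 := by simp [hs]
      rw [h2, ← Finset.sum_add_distrib]
      refine Finset.sum_congr rfl fun t _ => ?_
      rw [hlen]
      split_ifs with ht
      · subst ht; omega
      · omega
    simp only [μ, h1]
    rw [Nat.sub_add_cancel Nat.one_le_two_pow, Nat.sub_add_cancel Nat.one_le_two_pow, pow_succ,
      mul_comm]
  have hB : (D.comp (split k s)).Bounded F d := by
    intro a
    rcases split_cases (S := S) k a with rfl | rfl | ⟨-, ha⟩
    · simp only [brick_comp, copy_split, Fin.predAbove_castSucc_self, brick_split_castSucc]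
      refine ⟨fun t => ?_, fun t ht => ?_⟩
      · rw [hlen]
        split_ifs with hts
        · subst hts; omega
        · simpa using (hD k).1 t
      · have : t ≠ s := fun h => ht (h ▸ hs)
        simp [Prefix.single, this, (hD k).2 t ht]
    · simp only [brick_comp, copy_split, Fin.predAbove_succ_self, brick_split_succ]
      refine ⟨fun t => ?_, fun t ht => ?_⟩
      · rw [hlen]
        split_ifs with hts
        · subst hts; omega
        · simpa using (hD k).1 t
      · have : t ≠ s := fun h => ht (h ▸ hs)
        simp [Prefix.single, this, (hD k).2 t ht]
    · simpa [ha] using hD (k.predAbove a)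
  have hsum : ∑ a, μ ((D.comp (split k s)).brick a) < r := by
    -- With the first half `k.castSucc` set apart, `succAbove` matches the other pieces with the old
    -- bricks; the second half takes the place of `k`.
    rw [← h, Fin.sum_univ_succAbove _ k.castSucc,
      ← Finset.add_sum_erase _ _ (Finset.mem_univ k),
      ← Finset.add_sum_erase _ (fun a => μ (D.brick a)) (Finset.mem_univ k)]
    have h1 : ∀ j ∈ Finset.univ.erase k,
        μ ((D.comp (split k s)).brick (k.castSucc.succAbove j)) = μ (D.brick j) := by
      intro j hj
      have hjk : j ≠ k := (Finset.mem_erase.1 hj).1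
      rcases split_cases (S := S) k (k.castSucc.succAbove j) with ha | ha | ⟨-, ha⟩
      · exact absurd ha (Fin.succAbove_ne _ _)
      · rw [← Fin.succAbove_castSucc_self] at ha
        exact absurd (Fin.succAbove_right_injective ha) hjk
      · simp [ha]
    rw [Finset.sum_congr rfl h1]
    have h2 := hμ false
    have h3 := hμ true
    simp only [brick_comp, copy_split, Fin.predAbove_castSucc_self, brick_split_castSucc,
      Fin.succAbove_castSucc_self, Fin.predAbove_succ_self, brick_split_succ]
    omega
  obtain ⟨P, U, hU, hE⟩ := ih _ hsum hB rfl
  refine ⟨P, (split k s).comp U, ?_, by rwa [← comp_assoc]⟩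
  have : (split k s).IsForest := by simpa using (IsForest.one (S := S) (m := N)).split k s
  exact this.comp hU

/-- Partitions with the same bricks differ by a permutation. -/
theorem exists_perm_of_subset {D : DyadicPartition S m P} {T : DyadicPartition S m Q}
    (h : ∀ a, ∃ b, T.copy b = D.copy a ∧ T.brick b = D.brick a) :
    ∃ hPQ : P = Q, ∃ σ : Equiv.Perm (Fin Q), hPQ ▸ D = T.comp (copies S σ) := by
  choose f hf1 hf2 using h
  have hmap (a : Fin P) (κ : S → ℕ → Bool) : T.map (f a, κ) = D.map (a, κ) := by
    simp [map, hf1, hf2]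
  have hf : Function.Bijective f := by
    constructor
    · intro a b hab
      have h1 : D.map (a, fun _ _ => false) = D.map (b, fun _ _ => false) := by
        rw [← hmap, ← hmap, hab]
      exact congrArg Prod.fst (D.bijective_map.1 h1)
    -- Some brick `a` of `D` meets the brick `b` of `T`. It is also the brick `f a` of `T`, so `f a
    -- = b`.
    · intro b
      obtain ⟨a, κ, h1⟩ := D.exists_map_eq_of_mem (T.map (b, fun _ _ => false))
      rw [← hmap] at h1
      exact ⟨a, congrArg Prod.fst (T.bijective_map.1 h1)⟩
  obtain rfl : P = Q := by simpa using Fintype.card_of_bijective hf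
  refine ⟨rfl, Equiv.ofBijective f hf, ?_⟩
  ext1 a
  · exact (hf1 a).symm
  · simpa using (hf2 a).symm

/-- Exact bricks of the same size coincide as soon as they meet, so both partitions have the same
bricks. -/
theorem Exact.exists_perm {D : DyadicPartition S m P} {T : DyadicPartition S m Q}
    {F : Finset S} {d : ℕ} (hD : D.Exact F d) (hT : T.Exact F d) :
    ∃ hPQ : P = Q, ∃ σ : Equiv.Perm (Fin Q), hPQ ▸ D = T.comp (copies S σ) := by
  refine exists_perm_of_subset fun a => ?_
  obtain ⟨b, κ, h⟩ := T.exists_map_eq_of_mem (D.map (a, fun _ _ => false))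
  exact ⟨b, congrArg Prod.fst h, (hT b).eq_of_canonical_eq (hD a) (congrArg Prod.snd h)⟩

theorem exists_isForest_exact (S : Type*) (m : ℕ) (F : Finset S) (d : ℕ) :
    ∃ (N : ℕ) (D : DyadicPartition S m N), D.IsForest ∧ D.Exact F d := by
  have : (copies S (1 : Equiv.Perm (Fin m))).Bounded F d := fun a => ⟨by simp, by simp⟩
  obtain ⟨N, D, h1, h2⟩ := this.exists_isForest
  exact ⟨N, D, h1, by simpa using h2⟩

/-- In general a dyadic partition need not arise by iterated splits. An exact one does, since up to
numbering it is the exact partition obtained by splitting the trivial one. -/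
theorem Exact.isForest {D : DyadicPartition S m P} {F : Finset S} {d : ℕ} (hD : D.Exact F d) :
    D.IsForest := by
  obtain ⟨N, T, h1, h2⟩ := exists_isForest_exact S m F d
  obtain ⟨rfl, σ, h⟩ := hD.exists_perm h2
  dsimp only at h
  rw [h]
  exact h1.perm σ

/-- Any two partitions have a common refinement, which is obtained from both by splits. -/
theorem exists_common_comp (D : DyadicPartition S m P) (T : DyadicPartition S m Q) :
    ∃ (K : ℕ) (U : DyadicPartition S P K) (V : DyadicPartition S Q K),
      U.IsForest ∧ V.IsForest ∧ D.comp U = T.comp V := by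
  classical
  obtain ⟨F, d, hD⟩ := D.exists_bounded
  obtain ⟨F', d', hT⟩ := T.exists_bounded
  have hD' : D.Bounded (F ∪ F') (max d d') := fun a =>
    (hD a).mono Finset.subset_union_left (le_max_left _ _)
  have hT' : T.Bounded (F ∪ F') (max d d') := fun a =>
    (hT a).mono Finset.subset_union_right (le_max_right _ _)
  obtain ⟨K, U, hU, hDU⟩ := hD'.exists_isForest
  obtain ⟨K', V, hV, hTV⟩ := hT'.exists_isForest
  obtain ⟨rfl, σ, h⟩ := hDU.exists_perm hTV
  exact ⟨K, U, V.comp (copies S σ), hU, hV.perm σ, by rw [← comp_assoc]; exact h⟩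

end DyadicPartition

/-! ### The action of the twisted groupoid on labelled points -/

section Model

attribute [local instance] arrowAction

variable {G S : Type*} [Group G] [MulAction G S]

/-- Left translation of a prefix. -/
def Prefix.translate (g : G) (ψ : Prefix S) : Prefix S where
  word s := ψ.word (g⁻¹ • s)
  finite := by
    have : {s : S | ψ.word (g⁻¹ • s) ≠ []} = (g⁻¹ • ·) ⁻¹' {s | ψ.word s ≠ []} := rfl
    rw [this]
    exact ψ.finite.preimage (MulAction.injective _).injOn

theorem Prefix.smul_canonical (g : G) (ψ : Prefix S) (κ : S → ℕ → Bool) :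
    g • ψ.canonical κ = (ψ.translate g).canonical (g • κ) := rfl

theorem Prefix.translate_single (g : G) (s : S) (b : Bool) :
    (Prefix.single s b).translate g = Prefix.single (g • s) b := by
  ext1 t
  by_cases h : t = g • s
  · simp [translate, single, h]
  · have h' : g⁻¹ • t ≠ s := fun h' => h (inv_smul_eq_iff.1 h')
    simp [translate, single, h, h']

@[simp]
theorem Prefix.translate_empty (g : G) : (Prefix.empty S).translate g = Prefix.empty S := rfl

/-- The action of a tuple of labels on labelled points. -/
def labelEquiv {n : ℕ} (g : Fin n → G) : Cube S n × G ≃ Cube S n × G where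
  toFun x := ((x.1.1, g x.1.1 • x.1.2), g x.1.1 * x.2)
  invFun x := ((x.1.1, (g x.1.1)⁻¹ • x.1.2), (g x.1.1)⁻¹ * x.2)
  left_inv x := by simp
  right_inv x := by simp

/-- The action of a word on labelled points. -/
def Word.eval : ∀ {m n : ℕ}, Word G S m n → (Cube S m × G ≃ Cube S n × G)
  | _, _, .bt h => h.1.toEquiv.prodCongr (Equiv.refl G)
  | _, _, .label g => labelEquiv g
  | _, _, .id _ => Equiv.refl _
  | _, _, .comp w v => v.eval.trans w.eval
  | _, _, .inv w => w.eval.symm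

/-- Translation by `g k` carries the halves at `s` to the halves at `g k • s` and preserves the
digit. -/
theorem eval_split {n : ℕ} (g : Fin n → G) (k : Fin n) (s : S) (x : Cube S (n + 1)) (c : G) :
    labelEquiv g ((DyadicPartition.split k s).map x, c) =
      ((DyadicPartition.split k (g k • s)).map (labelEquiv (g ∘ k.predAbove) (x, c)).1,
        (labelEquiv (g ∘ k.predAbove) (x, c)).2) := by
  obtain ⟨a, κ⟩ := x
  simp only [labelEquiv, DyadicPartition.map, Equiv.coe_fn_mk, DyadicPartition.copy_split,
    Function.comp_apply, Prod.mk.injEq, true_and, and_true]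
  rw [Prefix.smul_canonical]
  congr 1
  rcases DyadicPartition.split_cases (S := S) k a with rfl | rfl | ⟨-, ha⟩
  · simp [Prefix.translate_single]
  · simp [Prefix.translate_single]
  · simp [ha]

/-- Soundness of the model, which lets the action descend from words to the groupoid. -/
theorem Rel.eval_eq {m n : ℕ} {w v : Word G S m n} (h : Rel w v) : w.eval = v.eval := by
  induction h with
  | refl w => rfl
  | symm _ ih => exact ih.symm
  | trans _ _ ih ih' => exact ih.trans ih'
  | comp_congr _ _ ih ih' => simp [Word.eval, ih, ih']
  | inv_congr _ ih => simp [Word.eval, ih]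
  | assoc w v u => rfl
  | id_comp w => rfl
  | comp_id w => rfl
  | inv_comp w => simp [Word.eval]
  | comp_inv w => simp [Word.eval]
  | bt_comp h h' h'' e =>
    ext1 x
    simp only [Word.eval, e]
    rfl
  | label_comp g g' =>
    ext1 x
    simp [Word.eval, labelEquiv, mul_smul, mul_assoc]
  | split g k s =>
    ext1 x
    obtain ⟨x, c⟩ := x
    obtain ⟨y, rfl⟩ := (DyadicPartition.split k s).bijective_map.2 x
    have h1 : (labelEquiv g ((DyadicPartition.split k s).map y, c)) =
      ((DyadicPartition.split k (g k • s)).map (labelEquiv (g ∘ k.predAbove) (y, c)).1,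
        (labelEquiv (g ∘ k.predAbove) (y, c)).2) := eval_split g k s y c
    have h2 (t : S) (z : Cube S (_ + 1) × G) :
        (Word.bt (BTHom.split k t)).eval ((DyadicPartition.split k t).map z.1, z.2) = z :=
      Prod.ext (DyadicPartition.homeo_symm_map _ _) rfl
    change (Word.bt (BTHom.split k (g k • s))).eval (labelEquiv g _) =
      labelEquiv (g ∘ k.predAbove) ((Word.bt (BTHom.split k s)).eval _)
    rw [h1, h2, h2 s (y, c)]
  | perm g σ =>
    ext1 x
    rfl

/-! ### Normal forms -/

namespace TwistedHom

variable {m n p q : ℕ}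

/-- Composition in the twisted groupoid. -/
def comp : TwistedHom G S n p → TwistedHom G S m n → TwistedHom G S m p :=
  Quotient.map₂ Word.comp fun _ _ h _ _ h' => Rel.comp_congr h h'

/-- Inversion in the twisted groupoid. -/
def inv : TwistedHom G S m n → TwistedHom G S n m :=
  Quotient.map Word.inv fun _ _ h => Rel.inv_congr h

variable (G S) in
/-- The identity of an object of the twisted groupoid. -/
def id (n : ℕ) : TwistedHom G S n n := Quotient.mk _ (Word.id n)

/-- The class of a tuple of labels. -/
def label (g : Fin n → G) : TwistedHom G S n n := Quotient.mk _ (Word.label g)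

variable (G) in
/-- The class of a morphism of the Brin-Thompson groupoid. -/
def bt (h : BTHom S m n) : TwistedHom G S m n := Quotient.mk _ (Word.bt h)

theorem comp_assoc (a : TwistedHom G S p q) (b : TwistedHom G S n p) (c : TwistedHom G S m n) :
    (a.comp b).comp c = a.comp (b.comp c) := by
  induction a using Quotient.ind
  induction b using Quotient.ind
  induction c using Quotient.ind
  exact Quotient.sound (Rel.assoc _ _ _)

@[simp]
theorem id_comp (a : TwistedHom G S m n) : (id G S n).comp a = a := by
  induction a using Quotient.ind
  exact Quotient.sound (Rel.id_comp _)

@[simp]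
theorem comp_id (a : TwistedHom G S m n) : a.comp (id G S m) = a := by
  induction a using Quotient.ind
  exact Quotient.sound (Rel.comp_id _)

@[simp]
theorem inv_comp (a : TwistedHom G S m n) : a.inv.comp a = id G S m := by
  induction a using Quotient.ind
  exact Quotient.sound (Rel.inv_comp _)

@[simp]
theorem comp_inv (a : TwistedHom G S m n) : a.comp a.inv = id G S n := by
  induction a using Quotient.ind
  exact Quotient.sound (Rel.comp_inv _)

@[simp]
theorem inv_comp_cancel (a : TwistedHom G S m n) (b : TwistedHom G S p m) :
    a.inv.comp (a.comp b) = b := by rw [← comp_assoc, inv_comp, id_comp]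

@[simp]
theorem comp_inv_cancel (a : TwistedHom G S m n) (b : TwistedHom G S p n) :
    a.comp (a.inv.comp b) = b := by rw [← comp_assoc, comp_inv, id_comp]

theorem eq_inv_comp {a : TwistedHom G S m n} {b : TwistedHom G S p m} {c : TwistedHom G S p n}
    (h : a.comp b = c) : b = a.inv.comp c := by rw [← h, inv_comp_cancel]

theorem eq_comp_inv {a : TwistedHom G S n p} {b : TwistedHom G S m n} {c : TwistedHom G S m p}
    (h : a.comp b = c) : a = c.comp b.inv := by rw [← h, comp_assoc, comp_inv, comp_id]

theorem comp_left_cancel {a : TwistedHom G S m n} {b c : TwistedHom G S p m}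
    (h : a.comp b = a.comp c) : b = c := by rw [eq_inv_comp h, inv_comp_cancel]

theorem inv_eq_of_comp_eq_id {a : TwistedHom G S m n} {b : TwistedHom G S n m}
    (h : a.comp b = id G S n) : a.inv = b := by rw [eq_inv_comp h, comp_id]

theorem comp_inv_rev (a : TwistedHom G S n p) (b : TwistedHom G S m n) :
    (a.comp b).inv = b.inv.comp a.inv :=
  inv_eq_of_comp_eq_id (by simp [comp_assoc])

@[simp]
theorem inv_inv (a : TwistedHom G S m n) : a.inv.inv = a := inv_eq_of_comp_eq_id (by simp)

theorem label_comp_label (g h : Fin n → G) :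
    (label g : TwistedHom G S n n).comp (label h) = label (g * h) :=
  Quotient.sound (Rel.label_comp g h)

/-- Not one of the defining relations, but an idempotent in a groupoid is an identity. The same
argument gives `part_one`. -/
theorem label_one : (label 1 : TwistedHom G S n n) = id G S n := by
  have h := label_comp_label (S := S) (1 : Fin n → G) 1
  rw [mul_one] at h
  exact comp_left_cancel (h.trans (comp_id _).symm)

theorem inv_label (g : Fin n → G) : (label g : TwistedHom G S n n).inv = label g⁻¹ :=
  inv_eq_of_comp_eq_id (by rw [label_comp_label, mul_inv_cancel, label_one])

theorem bt_comp_bt {h : BTHom S n p} {h' : BTHom S m n} {h'' : BTHom S m p}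
    (e : h''.1 = h'.1.trans h.1) : (bt G h).comp (bt G h') = bt G h'' :=
  Quotient.sound (Rel.bt_comp h h' h'' e)

variable (G) in
/-- The class of the homeomorphism that is given by a dyadic partition. -/
noncomputable def part {N : ℕ} (D : DyadicPartition S m N) : TwistedHom G S N m :=
  bt G ⟨D.homeo, N, DyadicPartition.copies S 1, D,
    by rw [DyadicPartition.homeo_copies_one]; rfl⟩

theorem bt_comp_part {N : ℕ} {h : BTHom S m n} {D : DyadicPartition S m N}
    {R : DyadicPartition S n N} (e : ∀ x, h.1 (D.map x) = R.map x) :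
    (bt G h).comp (part G D) = part G R :=
  bt_comp_bt (Homeomorph.ext fun x => (e x).symm)

theorem part_comp_part {N P : ℕ} (D : DyadicPartition S m N) (E : DyadicPartition S N P) :
    (part G D).comp (part G E) = part G (D.comp E) :=
  bt_comp_part fun x => (D.map_comp E x).symm

theorem part_one : part G (DyadicPartition.copies S (1 : Equiv.Perm (Fin n))) = id G S n := by
  have h := part_comp_part (G := G) (DyadicPartition.copies S (1 : Equiv.Perm (Fin n)))
    (DyadicPartition.copies S 1)
  rw [DyadicPartition.comp_copies_one] at h
  exact comp_left_cancel (h.trans (comp_id _).symm)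

theorem label_comp_part_split (g : Fin n → G) (k : Fin n) (s : S) :
    (label g).comp (part G (DyadicPartition.split k s)) =
      (part G (DyadicPartition.split k (g k • s))).comp (label (g ∘ k.predAbove)) := by
  -- `part` glues the pieces of a split while `BTHom.split` cuts them, so the defining relation is
  -- used with both splits inverted.
  have h (t : S) : bt G (BTHom.split k t) = (part G (DyadicPartition.split k t)).inv := by
    have := bt_comp_part (G := G) (h := BTHom.split k t) (D := DyadicPartition.split k t)
      (R := DyadicPartition.copies S 1) fun x => DyadicPartition.homeo_symm_map _ _
    rw [part_one] at this
    rw [eq_comp_inv this, id_comp]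
  have h' : (bt G (BTHom.split k (g k • s))).comp (label g) =
      (label (g ∘ k.predAbove)).comp (bt G (BTHom.split k s)) :=
    Quotient.sound (Rel.split g k s)
  rw [h, h] at h'
  rw [← comp_inv_cancel (part G (.split k (g k • s))) (label g), h', comp_assoc, comp_assoc,
    inv_comp, comp_id]

theorem label_comp_part_copies (g : Fin n → G) (σ : Equiv.Perm (Fin n)) :
    (label g).comp (part G (DyadicPartition.copies S σ)) =
      (part G (DyadicPartition.copies S σ)).comp (label (g ∘ σ)) :=
  Quotient.sound (Rel.perm g σ)

/-- The labels move past one split or permutation at a time, changing the directions of the splits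
on the way. The relations speak of splits and permutations only, hence the restriction to forests.
-/
theorem exists_label_comp_part {N : ℕ} {U : DyadicPartition S m N} (hU : U.IsForest)
    (g : Fin m → G) :
    ∃ (V : DyadicPartition S m N) (h : Fin N → G),
      (label g).comp (part G U) = (part G V).comp (label h) := by
  induction hU with
  | one => exact ⟨.copies S 1, g, by simp [part_one]⟩
  | split k s _ ih =>
    obtain ⟨V, h, e⟩ := ih
    refine ⟨V.comp (.split k (h k • s)), h ∘ k.predAbove, ?_⟩
    rw [← part_comp_part, ← comp_assoc, e, comp_assoc, label_comp_part_split, ← comp_assoc,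
      part_comp_part]
  | perm σ _ ih =>
    obtain ⟨V, h, e⟩ := ih
    refine ⟨V.comp (.copies S σ), h ∘ σ, ?_⟩
    rw [← part_comp_part, ← comp_assoc, e, comp_assoc, label_comp_part_copies, ← comp_assoc,
      part_comp_part]

/-- Every morphism cuts into bricks, applies labels and glues the bricks. -/
theorem exists_normal_form (f : TwistedHom G S m n) :
    ∃ (N : ℕ) (W : DyadicPartition S n N) (V : DyadicPartition S m N) (g : Fin N → G),
      f = (part G W).comp ((label g).comp (part G V).inv) := by
  induction f using Quotient.ind with
  | _ w =>
  induction w with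
  | bt h =>
    obtain ⟨f, N, D, R, rfl⟩ := h
    refine ⟨N, R, D, 1, ?_⟩
    rw [label_one, id_comp]
    exact eq_comp_inv (bt_comp_part fun x => by simp [← DyadicPartition.homeo_apply])
  | label g =>
    refine ⟨_, .copies S 1, .copies S 1, g, ?_⟩
    rw [part_one, inv_eq_of_comp_eq_id (id_comp _), id_comp, comp_id]
    rfl
  | id n =>
    refine ⟨_, .copies S 1, .copies S 1, 1, ?_⟩
    rw [part_one, inv_eq_of_comp_eq_id (id_comp _), id_comp, comp_id, label_one]
    rfl
  | comp w v ihw ihv =>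
    obtain ⟨N, W, V, g, hw⟩ := ihw
    obtain ⟨N', W', V', g', hv⟩ := ihv
    -- The gluing by `W'` and the cutting by `V` meet in the middle. In a common refinement they
    -- cancel, after the labels of both factors have moved into it.
    obtain ⟨K, U, U', hU, hU', h⟩ := V.exists_common_comp W'
    obtain ⟨U₁, g₁, h₁⟩ := exists_label_comp_part hU g
    -- The labels `g'` have to pass the inverse of `U'`, so the rule is applied to `g'⁻¹` and then
    -- inverted in `h4`.
    obtain ⟨U₂, g₂, h₂⟩ := exists_label_comp_part hU' g'⁻¹
    refine ⟨K, W.comp U₁, V'.comp U₂, g₁ * g₂⁻¹, ?_⟩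
    have h3 : (part G V).inv.comp (part G W') = (part G U).comp (part G U').inv := by
      have e : (part G W').comp (part G U') = (part G V).comp (part G U) := by
        rw [part_comp_part, part_comp_part, h]
      rw [eq_comp_inv e, comp_assoc, inv_comp_cancel]
    have h4 : (part G U').inv.comp (label g') = (label g₂⁻¹).comp (part G U₂).inv := by
      have := congrArg inv h₂
      rwa [comp_inv_rev, comp_inv_rev, inv_label, inv_label, _root_.inv_inv] at this
    change (comp (Quotient.mk _ w) (Quotient.mk _ v) : TwistedHom G S _ _) = _
    rw [hw, hv, ← part_comp_part, ← part_comp_part, ← label_comp_label, comp_inv_rev]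
    calc _ = (part G W).comp ((label g).comp (((part G V).inv.comp (part G W')).comp
          ((label g').comp (part G V').inv))) := by simp only [comp_assoc]
      _ = (part G W).comp (((label g).comp (part G U)).comp
          (((part G U').inv.comp (label g')).comp (part G V').inv)) := by
            rw [h3]; simp only [comp_assoc]
      _ = _ := by rw [h₁, h4]; simp only [comp_assoc]
  | inv w ih =>
    obtain ⟨N, W, V, g, h⟩ := ih
    refine ⟨N, V, W, g⁻¹, ?_⟩
    change (inv (Quotient.mk _ w) : TwistedHom G S _ _) = _
    rw [h, comp_inv_rev, comp_inv_rev, inv_label, inv_inv, comp_assoc]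

/-- The action of a morphism on labelled points. -/
def eval (f : TwistedHom G S m n) : Cube S m × G ≃ Cube S n × G :=
  Quotient.lift Word.eval (fun _ _ h => Rel.eval_eq h) f

theorem eval_comp (a : TwistedHom G S n p) (b : TwistedHom G S m n) :
    (a.comp b).eval = b.eval.trans a.eval := by
  induction a using Quotient.ind
  induction b using Quotient.ind
  rfl

theorem eval_inv (a : TwistedHom G S m n) : a.inv.eval = a.eval.symm := by
  induction a using Quotient.ind
  rfl

theorem eval_part {N : ℕ} (D : DyadicPartition S m N) (x : Cube S N × G) :
    (part G D).eval x = (D.map x.1, x.2) := rfl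

theorem eval_label (g : Fin n → G) :
    (label g : TwistedHom G S n n).eval = labelEquiv g := rfl

/-- In a normal form, the coordinate in `G` shows that all labels are trivial. Then the coordinates
in `C^S` show that cutting and gluing use the same homeomorphism. -/
theorem eq_id_of_eval_eq {f : TwistedHom G S n n} (hf : f.eval = Equiv.refl _) :
    f = id G S n := by
  obtain ⟨N, W, V, g, rfl⟩ := exists_normal_form f
  have key (x : Cube S N × G) : (part G W).eval (labelEquiv g x) = (part G V).eval x := by
    have := congrArg (fun e => e ((part G V).eval x)) hf
    simpa [eval_comp, eval_inv, eval_label] using this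
  have hg : g = 1 := by
    funext a
    simpa [eval_part, labelEquiv] using congrArg Prod.snd (key ((a, fun _ _ => false), 1))
  subst hg
  have h : part G W = part G V := by
    refine congrArg (bt G) (Subtype.ext (Homeomorph.ext fun x => ?_))
    have h : W.map x = V.map x := by
      simpa [eval_part, labelEquiv] using congrArg Prod.fst (key (x, 1))
    exact h
  rw [h, label_one, id_comp, comp_inv]

end TwistedHom

end Model

/-! ### The twisted group as a group of local permutations -/

section Local

attribute [local instance] arrowAction

variable {G S : Type*}

/-- Points of `C^S` with a label in `G`. -/
abbrev Pt (G S : Type*) : Type _ := (S → ℕ → Bool) × G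

variable (G) in
/-- The canonical embedding of labelled points onto those over a dyadic brick. -/
def Prefix.emb (ψ : Prefix S) : Pt G S ↪ Pt G S where
  toFun y := (ψ.canonical y.1, y.2)
  inj' y z h := by
    simp only [Prod.mk.injEq] at h
    exact Prod.ext (ψ.canonical_injective h.1) h.2

theorem Prefix.emb_apply (ψ : Prefix S) (y : Pt G S) :
    ψ.emb G y = (ψ.canonical y.1, y.2) := rfl

theorem Prefix.emb_append (ψ φ : Prefix S) (y : Pt G S) :
    (ψ.append φ).emb G y = ψ.emb G (φ.emb G y) :=
  Prod.ext (ψ.canonical_append φ y.1) rfl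

@[simp]
theorem Prefix.emb_empty (y : Pt G S) : (Prefix.empty S).emb G y = y := rfl

theorem Prefix.mem_range_emb {ψ : Prefix S} {y : Pt G S} :
    y ∈ Set.range (ψ.emb G) ↔ y.1 ∈ ψ.brick := by
  rw [Prefix.mem_brick]
  constructor
  · rintro ⟨z, rfl⟩
    exact ⟨z.1, rfl⟩
  · rintro ⟨η, h⟩
    exact ⟨(η, y.2), Prod.ext h rfl⟩

theorem DyadicPartition.exists_emb_eq {N : ℕ} (D : DyadicPartition S 1 N) (y : Pt G S) :
    ∃ a z, (D.brick a).emb G z = y := by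
  obtain ⟨a, κ, h⟩ := D.exists_map_eq_of_mem (0, y.1)
  exact ⟨a, (κ, y.2), Prod.ext (congrArg Prod.snd h) rfl⟩

variable [Group G] [MulAction G S]

theorem Prefix.smul_emb (g : G) (ψ : Prefix S) (y : Pt G S) :
    g • ψ.emb G y = (ψ.translate g).emb G (g • y) := rfl

variable (G S) in
/-- Identification of the labelled points of `C^S(1)` with those of `C^S`. -/
def ptEquiv : Cube S 1 × G ≃ Pt G S := (Equiv.uniqueProd _ _).prodCongr (Equiv.refl G)

variable (G S) in
/-- The action of the twisted group on labelled points. -/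
def evalHom : SV G S →* Equiv.Perm (Pt G S) :=
  MonoidHom.mk' (fun f => (ptEquiv G S).permCongr f.eval) fun a b => by
    have h : (a * b).eval = b.eval.trans a.eval := TwistedHom.eval_comp a b
    ext1 y
    simp [h]

theorem evalHom_apply (f : SV G S) (y : Pt G S) :
    evalHom G S f y = ptEquiv G S (f.eval ((ptEquiv G S).symm y)) := rfl

theorem evalHom_injective : Function.Injective (evalHom G S) := by
  rw [injective_iff_map_eq_one]
  intro f hf
  refine TwistedHom.eq_id_of_eval_eq (Equiv.ext fun x => ?_)
  have := congrArg (fun e => (ptEquiv G S).symm (e (ptEquiv G S x))) hf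
  simpa [evalHom_apply] using this

variable (G S) in
/-- The group of permutations of labelled points that are given by the twisted group. -/
abbrev LocalPerm : Type _ := (evalHom G S).range

namespace LocalPerm

variable {N : ℕ}

/-- The element that maps the `a`-th brick of `D` to that of `R` by means of the label `g a`. -/
noncomputable def piece (D R : DyadicPartition S 1 N) (g : Fin N → G) : LocalPerm G S :=
  ⟨evalHom G S ((TwistedHom.part G R).comp
    ((TwistedHom.label g).comp (TwistedHom.part G D).inv)), _, rfl⟩

theorem piece_apply (D R : DyadicPartition S 1 N) (g : Fin N → G) (a : Fin N) (y : Pt G S) :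
    (piece D R g).1 ((D.brick a).emb G y) = (R.brick a).emb G (g a • y) := by
  have h : (ptEquiv G S).symm ((D.brick a).emb G y) = (TwistedHom.part G D).eval ((a, y.1), y.2) :=
    (Equiv.symm_apply_eq _).2 rfl
  simp only [piece, evalHom_apply, h, TwistedHom.eval_comp, TwistedHom.eval_inv,
    Equiv.trans_apply, Equiv.symm_apply_apply, TwistedHom.eval_label]
  rfl

theorem eq_piece {D R : DyadicPartition S 1 N} {g : Fin N → G} {e : LocalPerm G S}
    (h : ∀ a y, e.1 ((D.brick a).emb G y) = (R.brick a).emb G (g a • y)) : e = piece D R g := by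
  refine Subtype.ext (Equiv.ext fun y => ?_)
  obtain ⟨a, z, rfl⟩ := D.exists_emb_eq y
  rw [h, piece_apply]

/-- Every element is given by partitions and labels. -/
theorem exists_eq_piece_of_mem (e : LocalPerm G S) :
    ∃ (N : ℕ) (D R : DyadicPartition S 1 N) (g : Fin N → G), e = piece D R g := by
  obtain ⟨_, f, rfl⟩ := e
  obtain ⟨N, W, V, g, rfl⟩ := TwistedHom.exists_normal_form f
  exact ⟨N, V, W, g, rfl⟩

end LocalPerm

/-- Around every point, the permutation maps a dyadic brick to a dyadic brick by means of a
label. -/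
def IsLocal (e : Equiv.Perm (Pt G S)) : Prop :=
  ∀ κ, ∃ (ψ φ : Prefix S) (g : G) (η : S → ℕ → Bool), κ = ψ.canonical η ∧
    ∀ y, e (ψ.emb G y) = φ.emb G (g • y)

theorem LocalPerm.isLocal (e : LocalPerm G S) : IsLocal e.1 := by
  obtain ⟨N, D, R, g, rfl⟩ := e.exists_eq_piece_of_mem
  intro κ
  obtain ⟨a, z, h⟩ := D.exists_emb_eq (κ, (1 : G))
  exact ⟨_, _, g a, z.1, (congrArg Prod.fst h).symm, piece_apply D R g a⟩

/-- It suffices to check locality in a neighbourhood of every point. -/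
theorem IsLocal.of_eventually {e : Equiv.Perm (Pt G S)}
    (h : ∀ κ, ∃ (ψ φ : Prefix S) (g : G) (η : S → ℕ → Bool), κ = ψ.canonical η ∧
      ∀ᶠ ζ in 𝓝 η, ∀ c, e (ψ.emb G (ζ, c)) = φ.emb G (g • (ζ, c))) : IsLocal e := by
  intro κ
  obtain ⟨ψ, φ, g, η, rfl, h⟩ := h κ
  obtain ⟨α, η, rfl, hα⟩ := Prefix.exists_brick_subset h
  refine ⟨ψ.append α, φ.append (α.translate g), g, η, (ψ.canonical_append α η).symm, fun y => ?_⟩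
  rw [Prefix.emb_append, Prefix.emb_append, ← Prefix.smul_emb]
  exact hα y.1 y.2

/-- By compactness of `C^S`, finitely many local bricks cover the space, and these have a common
bound. -/
theorem IsLocal.exists_bounded {e : Equiv.Perm (Pt G S)} (he : IsLocal e) :
    ∃ (F : Finset S) (d : ℕ), ∀ κ, ∃ (ψ φ : Prefix S) (g : G) (η : S → ℕ → Bool),
      ψ.Bounded F d ∧ κ = ψ.canonical η ∧ ∀ y, e (ψ.emb G y) = φ.emb G (g • y) := by
  classical
  have := (isCompact_univ (X := S → ℕ → Bool)).induction_on
    (p := fun s => ∃ (F : Finset S) (d : ℕ), ∀ κ ∈ s,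
      ∃ (ψ φ : Prefix S) (g : G) (η : S → ℕ → Bool),
      ψ.Bounded F d ∧ κ = ψ.canonical η ∧ ∀ y, e (ψ.emb G y) = φ.emb G (g • y))
    ⟨∅, 0, by simp⟩
    (fun s t hst ⟨F, d, h⟩ => ⟨F, d, fun κ hκ => h κ (hst hκ)⟩)
    (fun s t ⟨F, d, h⟩ ⟨F', d', h'⟩ => by
      refine ⟨F ∪ F', max d d', fun κ hκ => ?_⟩
      rcases hκ with hκ | hκ
      · obtain ⟨ψ, φ, g, η, h1, h2⟩ := h κ hκ
        exact ⟨ψ, φ, g, η, h1.mono Finset.subset_union_left (le_max_left _ _), h2⟩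
      · obtain ⟨ψ, φ, g, η, h1, h2⟩ := h' κ hκ
        exact ⟨ψ, φ, g, η, h1.mono Finset.subset_union_right (le_max_right _ _), h2⟩)
    (fun κ _ => by
      obtain ⟨ψ, φ, g, η, rfl, h2⟩ := he κ
      obtain ⟨F, d, h1⟩ := ψ.exists_bounded
      refine ⟨ψ.brick, mem_nhdsWithin_of_mem_nhds
        (ψ.isOpen_brick.mem_nhds (ψ.canonical_mem_brick η)), F, d, fun κ hκ => ?_⟩
      obtain ⟨ζ, rfl⟩ := (ψ.mem_brick κ).1 hκ
      exact ⟨ψ, φ, g, ζ, h1, rfl, h2⟩)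
  simpa using this

/-- Exact bricks of a sufficient size lie inside the bricks on which `e` is given by one label.
Their images form a partition because `e` is bijective, so `e` is cut, label and glue. -/
theorem IsLocal.mem_range {e : Equiv.Perm (Pt G S)} (he : IsLocal e) :
    e ∈ (evalHom G S).range := by
  obtain ⟨F, d, h⟩ := he.exists_bounded
  obtain ⟨N, D, -, hD⟩ := DyadicPartition.exists_isForest_exact S 1 F d
  have key (a : Fin N) : ∃ (φ : Prefix S) (g : G),
      ∀ y, e ((D.brick a).emb G y) = φ.emb G (g • y) := by
    obtain ⟨ψ, φ, g, η, h1, h2, h3⟩ := h ((D.brick a).canonical fun _ _ => false)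
    obtain ⟨α, hα⟩ := h1.exists_append_eq (hD a) h2.symm
    refine ⟨φ.append (α.translate g), g, fun y => ?_⟩
    rw [← hα, Prefix.emb_append, h3, Prefix.smul_emb, Prefix.emb_append]
  choose φ g hφ using key
  let R : DyadicPartition S 1 N := .ofBijective (fun _ => 0) φ (by
    constructor
    · rintro ⟨a, κ⟩ ⟨b, η⟩ hab
      have hab' : (φ a).emb G (g a • (g a)⁻¹ • (κ, 1)) =
          (φ b).emb G (g b • (g b)⁻¹ • (η, 1)) := by
        rw [smul_inv_smul, smul_inv_smul]
        exact Prod.ext (congrArg Prod.snd hab) rfl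
      rw [← hφ, ← hφ, e.apply_eq_iff_eq] at hab'
      have := D.bijective_map.1 (a₁ := (a, ((g a)⁻¹ • (κ, (1 : G))).1))
        (a₂ := (b, ((g b)⁻¹ • (η, (1 : G))).1)) (Prod.ext (Subsingleton.elim _ _) (congrArg Prod.fst hab'))
      obtain rfl : a = b := congrArg Prod.fst this
      have h2 := (φ a).canonical_injective (congrArg Prod.snd hab)
      exact Prod.ext rfl h2
    · rintro ⟨j, κ⟩
      obtain ⟨a, z, hz⟩ := D.exists_emb_eq (e.symm (κ, 1))
      have h1 := hφ a z
      rw [hz, e.apply_symm_apply] at h1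
      exact ⟨(a, (g a • z).1), Prod.ext (Subsingleton.elim _ _) (congrArg Prod.fst h1).symm⟩)
  have : e = (LocalPerm.piece D R g).1 := by
    refine Equiv.ext fun y => ?_
    obtain ⟨a, z, rfl⟩ := D.exists_emb_eq y
    rw [LocalPerm.piece_apply, hφ]
    rfl
  rw [this]
  exact (LocalPerm.piece D R g).2

end Local

/-! ### Swaps of bricks and copies inside bricks -/

section Bricks

attribute [local instance] arrowAction

variable {G S : Type*}

namespace Prefix

/-- Two prefixes are disjoint if their dyadic bricks are. -/
def Disj (ψ φ : Prefix S) : Prop := Disjoint ψ.brick φ.brick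

theorem Disj.symm {ψ φ : Prefix S} (h : ψ.Disj φ) : φ.Disj ψ := Disjoint.symm h

theorem brick_append_subset (ψ α : Prefix S) : (ψ.append α).brick ⊆ ψ.brick := by
  intro κ h
  obtain ⟨η, rfl⟩ := (mem_brick _ _).1 h
  rw [canonical_append]
  exact ψ.canonical_mem_brick _

theorem Disj.append_left {ψ φ : Prefix S} (h : ψ.Disj φ) (α : Prefix S) :
    (ψ.append α).Disj φ := Disjoint.mono_left (brick_append_subset ψ α) h

theorem Disj.append_right {ψ φ : Prefix S} (h : ψ.Disj φ) (α : Prefix S) :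
    ψ.Disj (φ.append α) := Disjoint.mono_right (brick_append_subset φ α) h

theorem Disj.append {ψ φ : Prefix S} (h : ψ.Disj φ) (α β : Prefix S) :
    (ψ.append α).Disj (φ.append β) := (h.append_left α).append_right β

theorem Disj.append_same {ψ φ : Prefix S} (h : ψ.Disj φ) (α : Prefix S) :
    (α.append ψ).Disj (α.append φ) := by
  rw [Disj, Set.disjoint_left] at *
  intro κ h1 h2
  obtain ⟨η, rfl⟩ := (mem_brick _ _).1 h1
  obtain ⟨ζ, hζ⟩ := (mem_brick _ _).1 h2
  rw [canonical_append, canonical_append] at hζ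
  refine h (ψ.canonical_mem_brick η) ?_
  rw [← α.canonical_injective hζ]
  exact φ.canonical_mem_brick ζ

theorem disj_single (s : S) : (single s false).Disj (single s true) := by
  rw [Disj, Set.disjoint_left]
  intro κ h1 h2
  rw [mem_brick_single] at h1 h2
  simp [h1] at h2

theorem Disj.emb_notMem {ψ φ : Prefix S} (h : ψ.Disj φ) (y : Pt G S) :
    φ.emb G y ∉ Set.range (ψ.emb G) := fun h' =>
  Set.disjoint_left.1 h (mem_range_emb.1 h') (φ.canonical_mem_brick y.1)

theorem Disj.emb_ne {ψ φ : Prefix S} (h : ψ.Disj φ) (y z : Pt G S) :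
    ψ.emb G y ≠ φ.emb G z := fun h' => h.emb_notMem z ⟨y, h'⟩

theorem exists_emb_single_eq (s : S) (y : Pt G S) : ∃ b z, (single s b).emb G z = y := by
  obtain ⟨η, h⟩ := (mem_brick _ _).1 ((mem_brick_single s (y.1 s 0) y.1).2 rfl)
  exact ⟨_, (η, y.2), Prod.ext h rfl⟩

theorem single_append_comm {s t : S} (h : s ≠ t) (b c : Bool) :
    (single s b).append (single t c) = (single t c).append (single s b) := by
  ext1 r
  by_cases hs : r = s
  · subst hs
    simp [single, h]
  · simp [single, hs]

end Prefix

theorem DyadicPartition.disj_brick {N : ℕ} (D : DyadicPartition S 1 N) {a b : Fin N}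
    (h : a ≠ b) : (D.brick a).Disj (D.brick b) := by
  rw [Prefix.Disj, Set.disjoint_left]
  intro κ h1 h2
  exact h ((D.exists_unique (0, κ)).unique ⟨Subsingleton.elim _ _, h1⟩
    ⟨Subsingleton.elim _ _, h2⟩)

/-- The common source of the conjugation rules for copies inside bricks and for swaps. -/
theorem viaEmbedding_mul_eq {α β : Type*} {e : Equiv.Perm α} {i j : α ↪ β}
    {c : Equiv.Perm β} (h : ∀ x, c (i x) = j x) :
    c * e.viaEmbedding i = e.viaEmbedding j * c := by
  ext1 y
  by_cases hy : y ∈ Set.range i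
  · obtain ⟨x, rfl⟩ := hy
    simp [h, Equiv.Perm.viaEmbedding_apply]
  · have hy' : c y ∉ Set.range j := by
      rintro ⟨x, hx⟩
      rw [← h, c.apply_eq_iff_eq] at hx
      exact hy ⟨x, hx⟩
    simp [Equiv.Perm.viaEmbedding_apply_of_notMem _ _ _ hy,
      Equiv.Perm.viaEmbedding_apply_of_notMem _ _ _ hy']

/-- Two disjoint dyadic bricks together. -/
def sumEmb {P Q : Prefix S} (h : P.Disj Q) : Pt G S ⊕ Pt G S ↪ Pt G S :=
  ⟨Sum.elim (P.emb G) (Q.emb G),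
    (P.emb G).injective.sumElim (Q.emb G).injective h.emb_ne⟩

open Classical in
/-- The permutation that exchanges two disjoint dyadic bricks. -/
noncomputable def swapPerm (G : Type*) {S : Type*} (P Q : Prefix S) : Equiv.Perm (Pt G S) :=
  if h : P.Disj Q then Equiv.Perm.viaEmbedding (Equiv.sumComm _ _) (sumEmb h) else 1

theorem swapPerm_left {P Q : Prefix S} (h : P.Disj Q) (y : Pt G S) :
    swapPerm G P Q (P.emb G y) = Q.emb G y := by
  rw [swapPerm, dif_pos h]
  exact Equiv.Perm.viaEmbedding_apply _ (sumEmb h) (.inl y)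

theorem swapPerm_right {P Q : Prefix S} (h : P.Disj Q) (y : Pt G S) :
    swapPerm G P Q (Q.emb G y) = P.emb G y := by
  rw [swapPerm, dif_pos h]
  exact Equiv.Perm.viaEmbedding_apply _ (sumEmb h) (.inr y)

theorem swapPerm_of_notMem {P Q : Prefix S} {y : Pt G S} (hP : y ∉ Set.range (P.emb G))
    (hQ : y ∉ Set.range (Q.emb G)) : swapPerm G P Q y = y := by
  rw [swapPerm]
  split_ifs with h
  · refine Equiv.Perm.viaEmbedding_apply_of_notMem _ _ _ ?_
    rintro ⟨z | z, rfl⟩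
    · exact hP ⟨z, rfl⟩
    · exact hQ ⟨z, rfl⟩
  · rfl

variable [Group G] [MulAction G S]

namespace LocalPerm

theorem isLocal_viaEmbedding (P : Prefix S) (e : LocalPerm G S) :
    IsLocal (e.1.viaEmbedding (P.emb G)) := by
  refine .of_eventually fun κ => ?_
  by_cases h : κ ∈ P.brick
  · obtain ⟨η, rfl⟩ := (P.mem_brick κ).1 h
    obtain ⟨ψ, φ, g, η, rfl, he⟩ := e.isLocal η
    refine ⟨P.append ψ, P.append φ, g, η, (P.canonical_append ψ η).symm, .of_forall fun ζ c => ?_⟩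
    rw [Prefix.emb_append, Prefix.emb_append, Equiv.Perm.viaEmbedding_apply, he]
  · refine ⟨.empty S, .empty S, 1, κ, rfl, ?_⟩
    filter_upwards [P.isClosed_brick.isOpen_compl.mem_nhds h] with ζ hζ c
    rw [one_smul]
    exact Equiv.Perm.viaEmbedding_apply_of_notMem _ _ _ fun h' => hζ (Prefix.mem_range_emb.1 h')

/-- The copy of an element inside a dyadic brick. -/
noncomputable def copyHom (P : Prefix S) : LocalPerm G S →* LocalPerm G S where
  toFun e := ⟨e.1.viaEmbedding (P.emb G), (isLocal_viaEmbedding P e).mem_range⟩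
  map_one' := Subtype.ext (map_one (Equiv.Perm.viaEmbeddingHom (P.emb G)))
  map_mul' e f := Subtype.ext (map_mul (Equiv.Perm.viaEmbeddingHom (P.emb G)) e.1 f.1)

theorem copyHom_apply (P : Prefix S) (e : LocalPerm G S) (y : Pt G S) :
    (copyHom P e).1 (P.emb G y) = P.emb G (e.1 y) := Equiv.Perm.viaEmbedding_apply _ _ _

theorem copyHom_apply_of_notMem (P : Prefix S) (e : LocalPerm G S) {y : Pt G S}
    (h : y ∉ Set.range (P.emb G)) : (copyHom P e).1 y = y :=
  Equiv.Perm.viaEmbedding_apply_of_notMem _ _ _ h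

theorem copyHom_apply_of_disj {P Q : Prefix S} (h : P.Disj Q) (e : LocalPerm G S)
    (y : Pt G S) : (copyHom P e).1 (Q.emb G y) = Q.emb G y :=
  copyHom_apply_of_notMem P e (h.emb_notMem y)

theorem ext_apply {e f : LocalPerm G S} (h : ∀ y, e.1 y = f.1 y) : e = f :=
  Subtype.ext (Equiv.ext h)

theorem mul_apply (e f : LocalPerm G S) (y : Pt G S) : (e * f).1 y = e.1 (f.1 y) := rfl

theorem inv_apply_eq {e : LocalPerm G S} {y z : Pt G S} (h : e.1 y = z) : e⁻¹.1 z = y := by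
  rw [← h]
  exact e.1.symm_apply_apply y

theorem copyHom_copyHom (P Q : Prefix S) (e : LocalPerm G S) :
    copyHom P (copyHom Q e) = copyHom (P.append Q) e := by
  refine ext_apply fun y => ?_
  by_cases hy : y ∈ Set.range (P.emb G)
  · obtain ⟨y, rfl⟩ := hy
    rw [copyHom_apply]
    by_cases hy : y ∈ Set.range (Q.emb G)
    · obtain ⟨y, rfl⟩ := hy
      rw [copyHom_apply, ← Prefix.emb_append, ← Prefix.emb_append, copyHom_apply]
    · rw [copyHom_apply_of_notMem _ _ hy, copyHom_apply_of_notMem]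
      rintro ⟨z, hz⟩
      rw [Prefix.emb_append] at hz
      exact hy ⟨z, (P.emb G).injective hz⟩
  · rw [copyHom_apply_of_notMem _ _ hy, copyHom_apply_of_notMem]
    rintro ⟨z, rfl⟩
    exact hy ⟨_, (Prefix.emb_append _ _ _).symm⟩

theorem conj_copyHom {P Q : Prefix S} {c : LocalPerm G S}
    (h : ∀ y, c.1 (P.emb G y) = Q.emb G y) (e : LocalPerm G S) :
    c * copyHom P e * c⁻¹ = copyHom Q e :=
  mul_inv_eq_of_eq_mul (Subtype.ext (viaEmbedding_mul_eq h))

theorem isLocal_swapPerm (P Q : Prefix S) : IsLocal (swapPerm G P Q) := by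
  by_cases hPQ : P.Disj Q
  swap
  · rw [swapPerm, dif_neg hPQ]
    exact (1 : LocalPerm G S).isLocal
  refine .of_eventually fun κ => ?_
  by_cases hP : κ ∈ P.brick
  · obtain ⟨η, rfl⟩ := (P.mem_brick κ).1 hP
    refine ⟨P, Q, 1, η, rfl, .of_forall fun ζ c => ?_⟩
    rw [one_smul, swapPerm_left hPQ]
  by_cases hQ : κ ∈ Q.brick
  · obtain ⟨η, rfl⟩ := (Q.mem_brick κ).1 hQ
    refine ⟨Q, P, 1, η, rfl, .of_forall fun ζ c => ?_⟩
    rw [one_smul, swapPerm_right hPQ]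
  refine ⟨.empty S, .empty S, 1, κ, rfl, ?_⟩
  filter_upwards [P.isClosed_brick.isOpen_compl.mem_nhds hP,
    Q.isClosed_brick.isOpen_compl.mem_nhds hQ] with ζ hζ hζ' c
  rw [one_smul]
  exact swapPerm_of_notMem (fun h' => hζ (Prefix.mem_range_emb.1 h'))
    fun h' => hζ' (Prefix.mem_range_emb.1 h')

variable (G) in
/-- The element that exchanges two disjoint dyadic bricks. -/
noncomputable def swap (P Q : Prefix S) : LocalPerm G S :=
  ⟨swapPerm G P Q, (isLocal_swapPerm P Q).mem_range⟩

theorem swap_left {P Q : Prefix S} (h : P.Disj Q) (y : Pt G S) :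
    (swap G P Q).1 (P.emb G y) = Q.emb G y := swapPerm_left h y

theorem swap_right {P Q : Prefix S} (h : P.Disj Q) (y : Pt G S) :
    (swap G P Q).1 (Q.emb G y) = P.emb G y := swapPerm_right h y

theorem swap_of_notMem {P Q : Prefix S} {y : Pt G S} (hP : y ∉ Set.range (P.emb G))
    (hQ : y ∉ Set.range (Q.emb G)) : (swap G P Q).1 y = y := swapPerm_of_notMem hP hQ

theorem swap_of_disj {P Q R : Prefix S} (hP : P.Disj R) (hQ : Q.Disj R) (y : Pt G S) :
    (swap G P Q).1 (R.emb G y) = R.emb G y :=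
  swap_of_notMem (hP.emb_notMem y) (hQ.emb_notMem y)

theorem conj_swap {P Q P' Q' : Prefix S} {c : LocalPerm G S} (h : P.Disj Q) (h' : P'.Disj Q')
    (hP : ∀ y, c.1 (P.emb G y) = P'.emb G y) (hQ : ∀ y, c.1 (Q.emb G y) = Q'.emb G y) :
    c * swap G P Q * c⁻¹ = swap G P' Q' := by
  refine mul_inv_eq_of_eq_mul (Subtype.ext ?_)
  simp only [swap, swapPerm, dif_pos h, dif_pos h']
  refine viaEmbedding_mul_eq ?_
  rintro (y | y)
  exacts [hP y, hQ y]

theorem copyHom_swap (R : Prefix S) {P Q : Prefix S} (h : P.Disj Q) :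
    copyHom R (swap G P Q) = swap G (R.append P) (R.append Q) := by
  refine ext_apply fun y => ?_
  by_cases hy : y ∈ Set.range (R.emb G)
  · obtain ⟨y, rfl⟩ := hy
    rw [copyHom_apply]
    by_cases hP : y ∈ Set.range (P.emb G)
    · obtain ⟨y, rfl⟩ := hP
      rw [swap_left h, ← Prefix.emb_append, ← Prefix.emb_append, swap_left (h.append_same R)]
    by_cases hQ : y ∈ Set.range (Q.emb G)
    · obtain ⟨y, rfl⟩ := hQ
      rw [swap_right h, ← Prefix.emb_append, ← Prefix.emb_append, swap_right (h.append_same R)]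
    rw [swap_of_notMem hP hQ, swap_of_notMem]
    · rintro ⟨z, hz⟩
      rw [Prefix.emb_append] at hz
      exact hP ⟨z, (R.emb G).injective hz⟩
    · rintro ⟨z, hz⟩
      rw [Prefix.emb_append] at hz
      exact hQ ⟨z, (R.emb G).injective hz⟩
  · rw [copyHom_apply_of_notMem _ _ hy, swap_of_notMem]
    · rintro ⟨z, rfl⟩
      exact hy ⟨_, (Prefix.emb_append _ _ _).symm⟩
    · rintro ⟨z, rfl⟩
      exact hy ⟨_, (Prefix.emb_append _ _ _).symm⟩

/-- A swap of two bricks is the product of the swaps of their halves. -/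
theorem swap_eq_mul {P Q : Prefix S} (h : P.Disj Q) (s : S) :
    swap G P Q = swap G (P.append (.single s false)) (Q.append (.single s false)) *
      swap G (P.append (.single s true)) (Q.append (.single s true)) := by
  have hs := Prefix.disj_single s
  refine ext_apply fun y => ?_
  rw [mul_apply]
  by_cases hP : y ∈ Set.range (P.emb G)
  · obtain ⟨y, rfl⟩ := hP
    obtain ⟨_ | _, y, rfl⟩ := Prefix.exists_emb_single_eq s y
    · rw [swap_left h, ← Prefix.emb_append, ← Prefix.emb_append,
        swap_of_disj (hs.symm.append_same P) (h.symm.append _ _), swap_left (h.append _ _)]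
    · rw [swap_left h, ← Prefix.emb_append, ← Prefix.emb_append, swap_left (h.append _ _),
        swap_of_disj (h.append _ _) (hs.append_same Q)]
  by_cases hQ : y ∈ Set.range (Q.emb G)
  · obtain ⟨y, rfl⟩ := hQ
    obtain ⟨_ | _, y, rfl⟩ := Prefix.exists_emb_single_eq s y
    · rw [swap_right h, ← Prefix.emb_append, ← Prefix.emb_append,
        swap_of_disj (h.append _ _) (hs.symm.append_same Q), swap_right (h.append _ _)]
    · rw [swap_right h, ← Prefix.emb_append, ← Prefix.emb_append, swap_right (h.append _ _),
        swap_of_disj (hs.append_same P) (h.symm.append _ _)]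
  have key (R α : Prefix S) (h : y ∉ Set.range (R.emb G)) :
      y ∉ Set.range ((R.append α).emb G) := by
    rintro ⟨z, rfl⟩
    exact h ⟨_, (Prefix.emb_append _ _ _).symm⟩
  rw [swap_of_notMem hP hQ, swap_of_notMem (key _ _ hP) (key _ _ hQ),
    swap_of_notMem (key _ _ hP) (key _ _ hQ)]

/-! ### Vanishing of homomorphisms to commutative groups -/

variable {A : Type*} [CommGroup A] (χ : LocalPerm G S →* A)

theorem map_eq_of_conj {c e f : LocalPerm G S} (h : c * e * c⁻¹ = f) : χ e = χ f := by
  simp [← h]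

/-- The swap of the two bricks conjugates one copy to the other. -/
theorem map_copyHom_eq {P Q : Prefix S} (h : P.Disj Q) (e : LocalPerm G S) :
    χ (copyHom P e) = χ (copyHom Q e) :=
  map_eq_of_conj χ (conj_copyHom (swap_left h) e)

/-- Moving `P` to `P'` and then `Q` to `Q'` conjugates one swap to the other. By the time `Q` moves,
`P` is out of the way, so `P` and `Q'` may overlap. -/
theorem map_swap_eq {P Q P' Q' : Prefix S} (h : P.Disj Q) (h' : P'.Disj Q') (h1 : P.Disj P')
    (h3 : Q.Disj P') (h4 : Q.Disj Q') :
    χ (swap G P Q) = χ (swap G P' Q') := by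
  refine map_eq_of_conj χ (c := swap G Q Q' * swap G P P') (conj_swap h h' (fun y => ?_) fun y => ?_)
  · rw [mul_apply, swap_left h1, swap_of_disj h3 h'.symm]
  · rw [mul_apply, swap_of_disj h h3.symm, swap_left h4]

/-- The swap and the two swaps of halves are all conjugate to the swap of the halves of `Z`. Hence
the value equals its own square. -/
theorem map_swap_of_room [Nonempty S] {P Q Z : Prefix S} (h : P.Disj Q) (hP : P.Disj Z)
    (hQ : Q.Disj Z) : χ (swap G P Q) = 1 := by
  obtain ⟨s⟩ := ‹Nonempty S›
  have hZ := (Prefix.disj_single s).append_same Z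
  have h1 (b : Bool) : χ (swap G (P.append (.single s b)) (Q.append (.single s b))) =
      χ (swap G P Q) := by
    rw [map_swap_eq χ h hZ (hP.append_right _) (hQ.append_right _)
      (hQ.append_right _), map_swap_eq χ (h.append _ _) hZ (hP.append _ _)
      (hQ.append _ _) (hQ.append _ _)]
  have h2 := congrArg χ (swap_eq_mul (G := G) h s)
  rw [map_mul, h1, h1] at h2
  exact left_eq_mul.1 h2

/-- Even if `P` and `Q` fill the space, the swap of two of their halves has room in the remaining
halves. -/
theorem map_swap [Nonempty S] (P Q : Prefix S) : χ (swap G P Q) = 1 := by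
  by_cases h : P.Disj Q
  · obtain ⟨s⟩ := ‹Nonempty S›
    have hs := Prefix.disj_single s
    rw [swap_eq_mul h s, map_mul, map_swap_of_room χ (h.append _ _) (hs.append_same P)
      (h.symm.append _ _), map_swap_of_room χ (h.append _ _) (hs.symm.append_same P)
      (h.symm.append _ _), one_mul]
  · have : swap G P Q = 1 := Subtype.ext (dif_neg h)
    rw [this, map_one]

/-- An element that up to trivial factors is the same on the two halves of the space is killed. -/
theorem map_copyHom_of_eq_mul {w e : LocalPerm G S} {s : S}
    (hw : ∀ P, χ (copyHom P w) = 1)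
    (h : e = w * copyHom (.single s false) e * copyHom (.single s true) e) (P : Prefix S) :
    χ (copyHom P e) = 1 := by
  have h1 (P : Prefix S) : χ (copyHom P e) = χ (copyHom (P.append (.single s false)) e) *
      χ (copyHom (P.append (.single s true)) e) := by
    have := congrArg (fun f => χ (copyHom P f)) h
    simpa [hw, copyHom_copyHom] using this
  have hs := Prefix.disj_single s
  -- With room `Z`, the copies in `P` and in its two halves are all conjugate to the copy in `Z`, so
  -- the value equals its square. An arbitrary `P` is then reduced to its halves, each of which is
  -- room for the other.
  have h2 {P Z : Prefix S} (hZ : P.Disj Z) : χ (copyHom P e) = 1 := by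
    have := h1 P
    rw [map_copyHom_eq χ (hZ.append_left (.single s false)),
      map_copyHom_eq χ (hZ.append_left (.single s true)), ← map_copyHom_eq χ hZ] at this
    exact left_eq_mul.1 this
  rw [h1, h2 (hs.append_same P), h2 (hs.symm.append_same P), one_mul]

variable (G) in
/-- The element that maps the halves at `s` to the halves at `t`. -/
noncomputable def exchange (s t : S) : LocalPerm G S :=
  piece (.split (0 : Fin 1) s) (.split (0 : Fin 1) t) 1

theorem exchange_apply (s t : S) (b : Bool) (y : Pt G S) :
    (exchange G s t).1 ((Prefix.single s b).emb G y) = (Prefix.single t b).emb G y := by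
  cases b
  · have := piece_apply (.split (0 : Fin 1) s) (.split (0 : Fin 1) t) (1 : Fin 2 → G)
      (Fin.castSucc 0) y
    rwa [DyadicPartition.brick_split_castSucc, DyadicPartition.brick_split_castSucc,
      Pi.one_apply, one_smul] at this
  · have := piece_apply (.split (0 : Fin 1) s) (.split (0 : Fin 1) t) (1 : Fin 2 → G)
      (Fin.succ 0) y
    rwa [DyadicPartition.brick_split_succ, DyadicPartition.brick_split_succ,
      Pi.one_apply, one_smul] at this

theorem exchange_self (s : S) : exchange G s s = 1 := by
  refine ext_apply fun y => ?_
  obtain ⟨b, y, rfl⟩ := Prefix.exists_emb_single_eq s y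
  exact exchange_apply s s b y

/-- The exchange puts the digit taken from `s` in front of the first digit at `t`; the copies in the
halves at `t` put it behind that digit. The swap of the bricks with prefixes `01` and `10` at `t`
corrects the order. -/
theorem exchange_eq_mul {s t : S} (h : s ≠ t) :
    exchange G s t = swap G ((Prefix.single t false).append (.single t true))
        ((Prefix.single t true).append (.single t false)) *
      copyHom (.single t false) (exchange G s t) * copyHom (.single t true) (exchange G s t) := by
  have ht := Prefix.disj_single t
  refine ext_apply fun y => ?_
  obtain ⟨c, y, rfl⟩ := Prefix.exists_emb_single_eq t y
  obtain ⟨b, y, rfl⟩ := Prefix.exists_emb_single_eq s y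
  have h1 : (exchange G s t).1 ((Prefix.single t c).emb G ((Prefix.single s b).emb G y)) =
      (Prefix.single t b).emb G ((Prefix.single t c).emb G y) := by
    rw [← Prefix.emb_append, ← Prefix.single_append_comm h, Prefix.emb_append, exchange_apply]
  rw [h1, mul_apply, mul_apply]
  have h2 : (copyHom (.single t false) (exchange G s t)).1
      ((copyHom (.single t true) (exchange G s t)).1
        ((Prefix.single t c).emb G ((Prefix.single s b).emb G y))) =
      (Prefix.single t c).emb G ((Prefix.single t b).emb G y) := by
    cases c
    · rw [copyHom_apply_of_disj ht.symm, copyHom_apply, exchange_apply]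
    · rw [copyHom_apply, copyHom_apply_of_disj ht, exchange_apply]
  rw [h2, ← Prefix.emb_append, ← Prefix.emb_append]
  cases b <;> cases c
  · rw [swap_of_disj (ht.symm.append_same _) (ht.symm.append _ _)]
  · rw [swap_right (ht.append _ _)]
  · rw [swap_left (ht.append _ _)]
  · rw [swap_of_disj (ht.append _ _) (ht.append_same _)]

theorem map_copyHom_exchange [Nonempty S] (s t : S) (P : Prefix S) :
    χ (copyHom P (exchange G s t)) = 1 := by
  by_cases h : s = t
  · subst h
    rw [exchange_self, map_one, map_one]
  · refine map_copyHom_of_eq_mul χ (fun P => ?_) (exchange_eq_mul h) P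
    rw [copyHom_swap _ ((Prefix.disj_single t).append _ _), map_swap]

variable (S) in
/-- The action of a single label. -/
noncomputable def root (g : G) : LocalPerm G S :=
  piece (.copies S (1 : Equiv.Perm (Fin 1))) (.copies S 1) fun _ => g

theorem root_apply (g : G) (y : Pt G S) : (root S g).1 y = g • y :=
  piece_apply (.copies S (1 : Equiv.Perm (Fin 1))) (.copies S 1) (fun _ => g) 0 y

/-- A label acts by itself inside each half at `s` and then carries these halves to the halves at `g
• s`, which is an exchange. -/
theorem map_copyHom_root [Nonempty S] (g : G) (P : Prefix S) :
    χ (copyHom P (root S g)) = 1 := by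
  have s : S := Classical.arbitrary S
  refine map_copyHom_of_eq_mul χ (w := exchange G s (g • s)) (s := s)
    (map_copyHom_exchange χ s (g • s)) (ext_apply fun y => ?_) P
  have hs := Prefix.disj_single s
  obtain ⟨b, y, rfl⟩ := Prefix.exists_emb_single_eq s y
  rw [root_apply, Prefix.smul_emb, Prefix.translate_single, mul_apply, mul_apply]
  cases b
  · rw [copyHom_apply_of_disj hs.symm, copyHom_apply, exchange_apply, root_apply]
  · rw [copyHom_apply, copyHom_apply_of_disj hs, exchange_apply, root_apply]

/-! ### Elements given by partitions -/

section Piece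

variable {N P : ℕ}

theorem piece_mul_piece (D R T : DyadicPartition S 1 N) (g h : Fin N → G) :
    piece R T h * piece D R g = piece D T (h * g) :=
  eq_piece fun a y => by rw [mul_apply, piece_apply, piece_apply, Pi.mul_apply, mul_smul]

theorem piece_self_one (D : DyadicPartition S 1 N) : piece D D (1 : Fin N → G) = 1 :=
  (eq_piece fun a y => by rw [Pi.one_apply, one_smul]; rfl).symm

theorem piece_comp (D R : DyadicPartition S 1 N) (U : DyadicPartition S N P) :
    piece (D.comp U) (R.comp U) (1 : Fin P → G) = piece D R 1 :=
  (eq_piece fun a y => by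
    simp only [DyadicPartition.brick_comp, Prefix.emb_append, piece_apply, Pi.one_apply,
      one_smul]).symm

/-- A homomorphism on a finite power of `G` is determined by its restrictions to the factors, and
one factor acts by a copy of a single label. -/
theorem map_piece_self [Nonempty S] (D : DyadicPartition S 1 N) (g : Fin N → G) :
    χ (piece D D g) = 1 := by
  classical
  let f : (Fin N → G) →* LocalPerm G S :=
    MonoidHom.mk' (fun g => piece D D g) fun g h => (piece_mul_piece D D D h g).symm
  have : χ.comp f = 1 := by
    refine MonoidHom.pi_ext fun a x => ?_
    have h : copyHom (D.brick a) (root S x) = piece D D (Pi.mulSingle a x) := by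
      refine eq_piece fun b y => ?_
      by_cases hab : b = a
      · subst hab
        rw [copyHom_apply, root_apply, Pi.mulSingle_eq_same]
      · rw [copyHom_apply_of_disj (D.disj_brick (Ne.symm hab)), Pi.mulSingle_eq_of_ne hab,
          one_smul]
    change χ (piece D D (Pi.mulSingle a x)) = 1
    rw [← h, map_copyHom_root]
  exact DFunLike.congr_fun this g

theorem map_piece_perm [Nonempty S] (D : DyadicPartition S 1 N) (σ : Equiv.Perm (Fin N)) :
    χ (piece D (D.comp (.copies S σ)) 1) = 1 := by
  induction σ using Equiv.Perm.swap_induction_on generalizing D with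
  | one => rw [DyadicPartition.comp_copies_one, piece_self_one, map_one]
  | swap_mul σ i j hij ih =>
    have h : swap G (D.brick i) (D.brick j) = piece D (D.comp (.copies S (.swap i j))) 1 := by
      refine eq_piece fun a y => ?_
      simp only [DyadicPartition.brick_comp, DyadicPartition.copy_copies,
        DyadicPartition.brick_copies, Prefix.append_empty, Pi.one_apply, one_smul]
      by_cases hi : a = i
      · rw [hi, Equiv.swap_apply_left, swap_left (D.disj_brick hij)]
      by_cases hj : a = j
      · rw [hj, Equiv.swap_apply_right, swap_right (D.disj_brick hij)]
      · rw [Equiv.swap_apply_of_ne_of_ne hi hj, swap_of_disj (D.disj_brick (Ne.symm hi))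
          (D.disj_brick (Ne.symm hj))]
    rw [← DyadicPartition.copies_comp_copies, ← DyadicPartition.comp_assoc,
      ← mul_one (1 : Fin N → G), ← piece_mul_piece _ (D.comp (.copies S (.swap i j))), map_mul, ih,
      ← h, map_swap, one_mul]

/-- Changing the direction of a split is a copy of an exchange inside the brick `k`. Changing which
brick is split is a matter of permuting bricks before and after the split. -/
theorem map_piece_split_split [Nonempty S] (D : DyadicPartition S 1 (N + 1)) (k : Fin (N + 1))
    (s t : S) : χ (piece (D.comp (.split 0 s)) (D.comp (.split k t)) 1) = 1 := by
  have h1 : χ (piece (D.comp (.split k s)) (D.comp (.split k t)) 1) = 1 := by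
    have h : copyHom (D.brick k) (exchange G s t) =
        piece (D.comp (.split k s)) (D.comp (.split k t)) 1 := by
      refine eq_piece fun a y => ?_
      simp only [DyadicPartition.brick_comp, DyadicPartition.copy_split, Pi.one_apply, one_smul,
        Prefix.emb_append]
      rcases DyadicPartition.split_cases (S := S) k a with rfl | rfl | ⟨ha, ha'⟩
      · simp only [Fin.predAbove_castSucc_self, DyadicPartition.brick_split_castSucc]
        rw [copyHom_apply, exchange_apply]
      · simp only [Fin.predAbove_succ_self, DyadicPartition.brick_split_succ]
        rw [copyHom_apply, exchange_apply]
      · rw [ha', ha', copyHom_apply_of_disj (D.disj_brick ha.symm)]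
    rw [← h, map_copyHom_exchange]
  obtain ⟨σ, hσ⟩ : ∃ σ, (D.comp (.copies S (.swap 0 k))).comp (.split 0 s) =
      (D.comp (.split k s)).comp (.copies S σ) := by
    have h := DyadicPartition.exists_perm_of_subset
      (D := (DyadicPartition.copies S (.swap 0 k)).comp (.split 0 s)) (T := .split k s) ?_
    · obtain ⟨_, σ, h⟩ := h
      refine ⟨σ, ?_⟩
      rw [DyadicPartition.comp_assoc, DyadicPartition.comp_assoc]
      exact congrArg D.comp h
    intro a
    simp only [DyadicPartition.copy_comp, DyadicPartition.brick_comp, DyadicPartition.copy_copies,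
      DyadicPartition.brick_copies, Prefix.empty_append, DyadicPartition.copy_split]
    rcases DyadicPartition.split_cases (S := S) 0 a with rfl | rfl | ⟨ha, ha'⟩
    · exact ⟨k.castSucc, by rw [Fin.predAbove_castSucc_self, Fin.predAbove_castSucc_self,
        Equiv.swap_apply_left], by
        rw [DyadicPartition.brick_split_castSucc, DyadicPartition.brick_split_castSucc]⟩
    · exact ⟨k.succ, by rw [Fin.predAbove_succ_self, Fin.predAbove_succ_self,
        Equiv.swap_apply_left], by
        rw [DyadicPartition.brick_split_succ, DyadicPartition.brick_split_succ]⟩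
    · obtain ⟨b, hb⟩ := k.predAbove_surjective (Equiv.swap 0 k (Fin.predAbove 0 a))
      refine ⟨b, hb, ?_⟩
      have hk : k.predAbove b ≠ k := by
        rw [hb]
        intro h
        rw [Equiv.swap_apply_eq_iff, Equiv.swap_apply_right] at h
        exact ha h
      rcases DyadicPartition.split_cases (S := S) k b with rfl | rfl | ⟨-, hb'⟩
      · exact absurd (Fin.predAbove_castSucc_self k) hk
      · exact absurd (Fin.predAbove_succ_self k) hk
      · rw [ha', hb']
  -- Read from the right: transpose the bricks `0` and `k` of `D`, undo the resulting renumbering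
  -- `σ` of the pieces, and change the direction from `s` to `t`.
  have h2 : piece (D.comp (.split 0 s)) (D.comp (.split k t)) (1 : Fin (N + 1 + 1) → G) =
      piece (D.comp (.split k s)) (D.comp (.split k t)) 1 *
      ((piece (D.comp (.split k s)) ((D.comp (.split k s)).comp (.copies S σ)) 1)⁻¹ *
        piece D (D.comp (.copies S (.swap 0 k))) 1) := by
    have h3 : (piece (D.comp (.split k s)) ((D.comp (.split k s)).comp (.copies S σ))
        (1 : Fin (N + 1 + 1) → G))⁻¹ =
        piece ((D.comp (.split k s)).comp (.copies S σ)) (D.comp (.split k s)) 1 :=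
      inv_eq_of_mul_eq_one_left (by rw [piece_mul_piece, mul_one, piece_self_one])
    rw [h3, ← hσ, ← piece_comp D (D.comp (.copies S (.swap 0 k))) (.split 0 s), piece_mul_piece,
      piece_mul_piece, mul_one, mul_one]
  rw [h2, map_mul, map_mul, map_inv, map_piece_perm, map_piece_perm, h1]
  simp

/-- The partition obtained by iterated splits of the first brick in the direction `s`. The index
only witnesses that there is a brick. -/
noncomputable def standard (s : S) : ∀ N, Fin N → DyadicPartition S 1 N
  | 0, a => a.elim0
  | 1, _ => .copies S 1
  | N + 2, _ => (standard s (N + 1) 0).comp (.split 0 s)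

/-- Up to the kernel of `χ`, a forest is determined by its number of bricks: neither the place nor
the direction of a split matters. -/
theorem map_piece_standard (s : S) {D : DyadicPartition S 1 N} (hD : D.IsForest) (a : Fin N) :
    χ (piece (standard s N a) D 1) = 1 := by
  have : Nonempty S := ⟨s⟩
  induction hD with
  | one =>
    have h : standard s 1 a = .copies S 1 := rfl
    rw [h, piece_self_one, map_one]
  | @split N D k t _ ih =>
    cases N with
    | zero => exact k.elim0
    | succ N =>
      have h : standard s (N + 2) a = (standard s (N + 1) 0).comp (.split 0 s) := rfl
      rw [h, ← mul_one (1 : Fin (N + 2) → G), ← piece_mul_piece _ (D.comp (.split 0 s)), map_mul,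
        piece_comp, ih, map_piece_split_split, one_mul]
  | @perm N D σ _ ih =>
    rw [← mul_one (1 : Fin N → G), ← piece_mul_piece _ D, map_mul, ih, map_piece_perm, one_mul]

theorem map_eq_one [Nonempty S] (e : LocalPerm G S) : χ e = 1 := by
  have s : S := Classical.arbitrary S
  obtain ⟨N, D, R, g, rfl⟩ := e.exists_eq_piece_of_mem
  obtain ⟨F, d, hD⟩ := D.exists_bounded
  -- Two refinements make both sides forests. The first makes `D` exact, the second `R`; the refined
  -- `D` remains a forest because `V` is one. Both are then compared with `standard`.
  obtain ⟨K, U, hU, hDU⟩ := hD.exists_isForest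
  obtain ⟨F', d', hR⟩ := (R.comp U).exists_bounded
  obtain ⟨K', V, hV, hRV⟩ := hR.exists_isForest
  have h1 : ((D.comp U).comp V).IsForest := hDU.isForest.comp hV
  have h2 : ((R.comp U).comp V).IsForest := hRV.isForest
  obtain ⟨a, -⟩ := ((D.comp U).comp V).exists_emb_eq (fun _ _ => false, (1 : G))
  have h3 : χ (piece D R 1) = 1 := by
    have := congrArg χ (piece_mul_piece (standard s K' a) ((D.comp U).comp V) ((R.comp U).comp V)
      (1 : Fin K' → G) 1)
    rwa [map_mul, mul_one, map_piece_standard χ s h1, map_piece_standard χ s h2, mul_one,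
      piece_comp, piece_comp] at this
  rw [← one_mul g, ← piece_mul_piece D D R, map_mul, map_piece_self, h3, one_mul]

theorem commutator_eq_top [Nonempty S] : commutator (LocalPerm G S) = ⊤ := by
  rw [eq_top_iff, ← Abelianization.ker_of]
  exact fun e _ => map_eq_one Abelianization.of e

end Piece

end LocalPerm

end Bricks

/-! ### Products of few commutators -/

theorem commutatorElement_mul_mul {H : Type*} [Group H] {u v a b : H} (hua : Commute u a)
    (hub : Commute u b) (hva : Commute v a) (hvb : Commute v b) :
    ⁅u * a, v * b⁆ = ⁅u, v⁆ * ⁅a, b⁆ := by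
  have h1 : Commute u⁻¹ (a * b * a⁻¹) :=
    ((hua.mul_right hub).mul_right hua.inv_right).inv_left
  have h2 : Commute v⁻¹ (a * b * a⁻¹ * b⁻¹) :=
    (((hva.mul_right hvb).mul_right hva.inv_right).mul_right hvb.inv_right).inv_left
  calc ⁅u * a, v * b⁆ = u * (a * v) * b * a⁻¹ * u⁻¹ * b⁻¹ * v⁻¹ := by
        rw [commutatorElement_def]; group
    _ = u * v * ((a * b * a⁻¹) * u⁻¹) * b⁻¹ * v⁻¹ := by rw [← hva.eq]; group
    _ = u * v * u⁻¹ * ((a * b * a⁻¹ * b⁻¹) * v⁻¹) := by rw [← h1.eq]; group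
    _ = _ := by rw [← h2.eq, commutatorElement_def, commutatorElement_def]; group

/-- If the conjugates of a subgroup under positive powers of `t` commute with it, then the
elements of its commutator subgroup are products of two commutators. -/
theorem exists_eq_commutator_mul_commutator {H K : Type*} [Group H] [Group K] (ι : H →* K) (t : K)
    (ht : ∀ (i : ℕ) (a b : H), Commute (t ^ (i + 1) * ι a * (t ^ (i + 1))⁻¹) (ι b))
    {e : H} (he : e ∈ commutator H) : ∃ x y u v : K, ι e = ⁅x, y⁆ * ⁅u, v⁆ := by
  -- The elements all of whose conjugates by `t ^ i` with `i ≥ 0` commute with the image of `ι`. The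
  -- subgroup is mapped into itself by conjugation by `t`, and contains all `t * ι a * t⁻¹`.
  let T : Subgroup K := ⨅ i : ℕ,
    (Subgroup.centralizer (ι.range : Set K)).comap (MulAut.conj (t ^ i)).toMonoidHom
  have hT {x : K} : x ∈ T ↔ ∀ (i : ℕ) (b : H), Commute (t ^ i * x * (t ^ i)⁻¹) (ι b) := by
    simp only [T, Subgroup.mem_iInf, Subgroup.mem_comap, Subgroup.mem_centralizer_iff]
    exact forall_congr' fun i =>
      ⟨fun h b => (h (ι b) ⟨b, rfl⟩).symm, by rintro h _ ⟨b, rfl⟩; exact (h b).symm⟩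
  have hcomm {x : K} (hx : x ∈ T) (b : H) : Commute x (ι b) := by simpa using hT.1 hx 0 b
  have hconj {x : K} (hx : x ∈ T) : t * x * t⁻¹ ∈ T := hT.2 fun i b => by
    have := hT.1 hx (i + 1) b
    rw [pow_succ] at this
    convert this using 1
    group
  have hι (a : H) : t * ι a * t⁻¹ ∈ T := hT.2 fun i b => by
    have := ht i a b
    rw [pow_succ] at this
    convert this using 1
    group
  have step (a b e : H) (h : ∃ x u v : K, u ∈ T ∧ v ∈ T ∧ ι e = ⁅x, t⁆ * ⁅u, v⁆) :
      ∃ x u v : K, u ∈ T ∧ v ∈ T ∧ ι (⁅a, b⁆ * e) = ⁅x, t⁆ * ⁅u, v⁆ := by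
    obtain ⟨x, u, v, hu, hv, h⟩ := h
    -- As `u` and `v` commute with the image of `ι`, multiplying them by `ι a` and `ι b` multiplies
    -- `⁅u, v⁆` by `⁅ι a, ι b⁆`; conjugation by `t` brings the results back into `T`. The first
    -- entry is chosen so that its commutator with `t` is `ι (⁅a, b⁆ * e)` times the inverse of the
    -- new second commutator.
    refine ⟨ι (⁅a, b⁆ * e) * (t * x * t⁻¹), t * (u * ι a) * t⁻¹, t * (v * ι b) * t⁻¹, ?_, ?_, ?_⟩
    · have : t * (u * ι a) * t⁻¹ = (t * u * t⁻¹) * (t * ι a * t⁻¹) := by group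
      exact this ▸ T.mul_mem (hconj hu) (hι a)
    · have : t * (v * ι b) * t⁻¹ = (t * v * t⁻¹) * (t * ι b * t⁻¹) := by group
      exact this ▸ T.mul_mem (hconj hv) (hι b)
    have h1 : ⁅t * (u * ι a) * t⁻¹, t * (v * ι b) * t⁻¹⁆ = t * (⁅u, v⁆ * ⁅ι a, ι b⁆) * t⁻¹ := by
      rw [← commutatorElement_mul_mul (hcomm hu a) (hcomm hu b) (hcomm hv a) (hcomm hv b),
        commutatorElement_def, commutatorElement_def]
      group
    have huv : ⁅u, v⁆ ∈ T := by
      rw [commutatorElement_def]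
      exact T.mul_mem (T.mul_mem (T.mul_mem hu hv) (T.inv_mem hu)) (T.inv_mem hv)
    have h2 : ⁅x, t⁆ * (ι e)⁻¹ = ⁅u, v⁆⁻¹ := by
      have h3 : ⁅x, t⁆ = ι e * ⁅u, v⁆⁻¹ := by rw [h]; group
      rw [h3, ← (hcomm (T.inv_mem huv) e).eq]
      group
    have h4 : ⁅ι (⁅a, b⁆ * e) * (t * x * t⁻¹), t⁆ =
        ι (⁅a, b⁆ * e) * (t * (⁅x, t⁆ * (ι e)⁻¹ * (ι ⁅a, b⁆)⁻¹) * t⁻¹) := by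
      rw [map_mul, commutatorElement_def, commutatorElement_def x t]
      group
    rw [h1, h4, h2, ← map_commutatorElement, (hcomm huv ⁅a, b⁆).eq]
    group
  rw [commutator_eq_closure] at he
  suffices ∃ x u v : K, u ∈ T ∧ v ∈ T ∧ ι e = ⁅x, t⁆ * ⁅u, v⁆ by
    obtain ⟨x, u, v, -, -, h⟩ := this
    exact ⟨x, t, u, v, h⟩
  induction he using Subgroup.closure_induction_left with
  | one => exact ⟨1, 1, 1, T.one_mem, T.one_mem, by simp⟩
  | mul_left c hc e _ ih =>
    obtain ⟨a, b, rfl⟩ := hc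
    exact step a b e ih
  | inv_mul_cancel c hc e _ ih =>
    obtain ⟨a, b, rfl⟩ := hc
    rw [commutatorElement_inv]
    exact step b a e ih

/-! ### Displacement in the twisted group and the count of commutators -/

section

attribute [local instance] arrowAction

variable {G S : Type*} [Group G] [MulAction G S]

namespace LocalPerm

/-- An element supported in a dyadic brick is the copy of an element inside the brick. -/
theorem exists_copyHom_eq {P : Prefix S} {e : LocalPerm G S}
    (he : ∀ y ∉ Set.range (P.emb G), e.1 y = y) : ∃ f, copyHom P f = e := by
  have key (y : Pt G S) : e.1 (P.emb G y) ∈ Set.range (P.emb G) := by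
    by_contra h
    exact h ⟨y, (e.1.injective (he _ h)).symm⟩
  have key' (y : Pt G S) : e.1.symm (P.emb G y) ∈ Set.range (P.emb G) := by
    by_contra h
    have := he _ h
    rw [e.1.apply_symm_apply] at this
    exact h ⟨y, this⟩
  choose f hf using key
  choose f' hf' using key'
  let E : Equiv.Perm (Pt G S) :=
    { toFun := f
      invFun := f'
      left_inv := fun y => (P.emb G).injective (by rw [hf', hf, e.1.symm_apply_apply])
      right_inv := fun y => (P.emb G).injective (by rw [hf, hf', e.1.apply_symm_apply]) }
  have hE : IsLocal E := by
    intro κ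
    obtain ⟨ψ, φ, g, η, h1, h2⟩ := e.isLocal (P.canonical κ)
    -- The brick on which `e` has one label is first shrunk into `P`; the second common extension
    -- below shrinks it again so that its image also lies in `P`.
    obtain ⟨β, α, ζ, h3, rfl, rfl, -⟩ := P.exists_common_append ψ h1
    have h4 (y : Pt G S) : P.emb G (f (β.emb G y)) = (φ.append (α.translate g)).emb G (g • y) := by
      rw [hf, ← Prefix.emb_append, h3, Prefix.emb_append, h2, Prefix.smul_emb, Prefix.emb_append]
    obtain ⟨γ, δ, ξ, h5, h6, h7, -⟩ := P.exists_common_append (φ.append (α.translate g))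
      (congrArg Prod.fst (h4 (ζ, 1)))
    refine ⟨β.append (δ.translate g⁻¹), γ, g, g⁻¹ • ξ, ?_, fun y => (P.emb G).injective ?_⟩
    · rw [Prefix.canonical_append, ← Prefix.smul_canonical, ← h7]
      congr 1
      exact (inv_smul_smul g ζ).symm
    · rw [Prefix.emb_append]
      refine (h4 _).trans ?_
      rw [Prefix.smul_emb, ← Prefix.emb_append, ← Prefix.emb_append, h5]
      congr 2
      ext1 s
      simp [Prefix.translate]
  refine ⟨⟨E, hE.mem_range⟩, ext_apply fun y => ?_⟩
  by_cases hy : y ∈ Set.range (P.emb G)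
  · obtain ⟨y, rfl⟩ := hy
    rw [copyHom_apply]
    exact hf y
  · rw [copyHom_apply_of_notMem _ _ hy, he _ hy]

theorem disj_single_not (s : S) (b : Bool) : (Prefix.single s b).Disj (Prefix.single s !b) := by
  cases b
  · exact Prefix.disj_single s
  · exact (Prefix.disj_single s).symm

/-- Some element has positive powers that move a half of the space off itself. -/
theorem exists_displacing (s : S) (b : Bool) : ∃ t : LocalPerm G S, ∀ (i : ℕ) (y : Pt G S),
    (t ^ (i + 1)).1 ((Prefix.single s b).emb G y) ∈ Set.range ((Prefix.single s !b).emb G) := by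
  set p := Prefix.single s b
  set q := Prefix.single s !b
  have hpq : p.Disj q := disj_single_not s b
  -- This maps `p` to `qqp` and `qq` to `qqq`, so every positive power maps `p` into `qq`.
  let t : LocalPerm G S := swap G p ((q.append q).append p) *
    (swap G (q.append p) ((q.append q).append q) * swap G (q.append p) (q.append q))
  have h1 (y : Pt G S) : t.1 (p.emb G y) = (q.append q).emb G (p.emb G y) := by
    have h := hpq.symm
    rw [mul_apply, mul_apply, swap_of_disj (h.append_left _) (h.append_left _),
      swap_of_disj (h.append_left _) ((h.append_left _).append_left _),
      swap_left ((hpq.append_right _).append_right _), Prefix.emb_append]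
  have h2 (y : Pt G S) : t.1 ((q.append q).emb G y) = (q.append q).emb G (q.emb G y) := by
    have h : (q.append p).Disj (q.append q) := hpq.append_same q
    rw [mul_apply, mul_apply, swap_right h, swap_left (h.append_right _),
      swap_of_disj ((hpq.append_right _).append_right _) (hpq.append_same _), Prefix.emb_append]
  refine ⟨t, fun i y => ?_⟩
  have h3 : ∃ z, (t ^ (i + 1)).1 (p.emb G y) = (q.append q).emb G z := by
    induction i with
    | zero => exact ⟨_, by rw [zero_add, pow_one, h1]⟩
    | succ i ih =>
      obtain ⟨z, hz⟩ := ih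
      exact ⟨_, by rw [pow_succ', mul_apply, hz, h2]⟩
  obtain ⟨z, hz⟩ := h3
  exact ⟨q.emb G z, by rw [hz, Prefix.emb_append]⟩

/-- An element that fixes a dyadic brick pointwise is a product of two commutators. -/
theorem exists_commutators_of_fix {s : S} {b : Bool} {W : Prefix S}
    (hW : W.Disj (Prefix.single s !b)) {e : LocalPerm G S}
    (he : ∀ y, e.1 (W.emb G y) = W.emb G y) : ∃ x y u v : LocalPerm G S, e = ⁅x, y⁆ * ⁅u, v⁆ := by
  have : Nonempty S := ⟨s⟩
  -- Conjugation by `c` makes `e` fix a whole half pointwise, so that the conjugate is supported in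
  -- the other half.
  let c : LocalPerm G S := swap G W (Prefix.single s !b)
  obtain ⟨f, hf⟩ : ∃ f, copyHom (Prefix.single s b) f = c * e * c⁻¹ := by
    refine exists_copyHom_eq fun y hy => ?_
    obtain ⟨b', z, rfl⟩ := Prefix.exists_emb_single_eq s y
    have hb : b' = !b := by
      cases b <;> cases b' <;> simp_all
    subst hb
    rw [mul_apply, mul_apply, inv_apply_eq (swap_left hW z), he, swap_left hW]
  obtain ⟨t, ht⟩ := exists_displacing (G := G) s b
  obtain ⟨x, y, u, v, h⟩ := exists_eq_commutator_mul_commutator (copyHom (Prefix.single s b)) t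
    (fun i a a' => by
      -- The conjugated copy is supported in the displaced half, so the supports are disjoint.
      have hd : Equiv.Perm.Disjoint
          (t ^ (i + 1) * copyHom (Prefix.single s b) a * (t ^ (i + 1))⁻¹).1
          (copyHom (Prefix.single s b) a').1 := by
        intro y
        by_cases hy : y ∈ Set.range ((Prefix.single s b).emb G)
        · left
          rw [mul_apply, mul_apply, copyHom_apply_of_notMem]
          · rw [← mul_apply, mul_inv_cancel]
            rfl
          · rintro ⟨z, hz⟩
            obtain ⟨z', hz'⟩ := ht i z
            rw [hz, ← mul_apply, mul_inv_cancel] at hz'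
            obtain ⟨z'', rfl⟩ := hy
            exact (disj_single_not s b).emb_ne _ _ hz'.symm
        · exact .inr (copyHom_apply_of_notMem _ _ hy)
      exact Subtype.ext hd.commute.eq)
    (e := f) (by rw [commutator_eq_top]; trivial)
  refine ⟨c⁻¹ * x * c, c⁻¹ * y * c, c⁻¹ * u * c, c⁻¹ * v * c, ?_⟩
  have h' : e = c⁻¹ * (⁅x, y⁆ * ⁅u, v⁆) * c := by
    rw [← h, hf]
    group
  rw [h']
  simp only [commutatorElement_def]
  group

/-- A commutator that maps one brick to another, given a third one. -/
theorem commutatorElement_apply {W R M : Prefix S} (h1 : W.Disj R) (h2 : W.Disj M)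
    (h3 : R.Disj M) (g : G) (y : Pt G S) :
    (⁅copyHom R (root S g) * swap G W R, swap G W M⁆ : LocalPerm G S).1 (W.emb G y) =
      R.emb G (g • y) := by
  -- The third brick hides `W` from the inverse of the first factor: the path is `W → M → M → W →
  -- R`.
  have h4 : (copyHom R (root S g) * swap G W R).1 (M.emb G y) = M.emb G y := by
    rw [mul_apply, swap_of_disj h2 h3, copyHom_apply_of_disj h3]
  rw [commutatorElement_def, mul_apply, mul_apply, mul_apply,
    inv_apply_eq (swap_right h2 y), inv_apply_eq h4, swap_right h2, mul_apply, swap_left h1,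
    copyHom_apply, root_apply]

/-- An element that moves a point of the space is a product of three commutators. -/
theorem exists_commutators_of_move [Nonempty S] {e : LocalPerm G S} {κ : S → ℕ → Bool}
    (he : (e.1 (κ, 1)).1 ≠ κ) : ∃ p q x y u v : LocalPerm G S, e = ⁅p, q⁆ * (⁅x, y⁆ * ⁅u, v⁆) := by
  have s : S := Classical.arbitrary S
  obtain ⟨ψ, φ, g, η, rfl, h⟩ := e.isLocal κ
  have he' : φ.canonical (g • η) ≠ ψ.canonical η := by
    have := h (η, 1)
    rw [Prefix.emb_apply] at this
    rw [this] at he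
    exact he
  classical
  -- A third point makes room for the brick `M` that the commutator needs.
  obtain ⟨μ, hμ⟩ := Infinite.exists_notMem_finset
    ({φ.canonical (g • η), ψ.canonical η} : Finset (S → ℕ → Bool))
  simp only [Finset.mem_insert, Finset.mem_singleton, not_or] at hμ
  obtain ⟨U₁, V₁, hU₁, hV₁, hu₁, hv₁, hd₁⟩ := t2_separation he'
  obtain ⟨U₂, V₂, hU₂, hV₂, hu₂, hv₂, hd₂⟩ := t2_separation hμ.1
  obtain ⟨U₃, V₃, hU₃, hV₃, hu₃, hv₃, hd₃⟩ := t2_separation hμ.2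
  have hg : Continuous fun ζ : S → ℕ → Bool => g • ζ :=
    continuous_pi fun s => continuous_apply (g⁻¹ • s)
  -- The small brick has to lie in one half at `s`, as `exists_commutators_of_fix` asks for.
  let b : Bool := ψ.canonical η s 0
  have hψ := ψ.continuous_canonical.continuousAt (x := η)
  have hφ := (φ.continuous_canonical.comp hg).continuousAt (x := η)
  have ev : ∀ᶠ ζ in 𝓝 η, (ψ.canonical ζ ∈ V₁ ∩ V₃ ∩ (Prefix.single s b).brick) ∧
      φ.canonical (g • ζ) ∈ U₁ ∩ V₂ :=
    (hψ.eventually_mem (((hV₁.inter hV₃).inter (Prefix.isOpen_brick _)).mem_nhds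
      ⟨⟨hv₁, hv₃⟩, (Prefix.mem_brick_single _ _ _).2 rfl⟩)).and
      (hφ.eventually_mem ((hU₁.inter hV₂).mem_nhds ⟨hu₁, hv₂⟩))
  obtain ⟨α, η, rfl, hα⟩ := Prefix.exists_brick_subset ev
  obtain ⟨M, μ, rfl, hM⟩ := Prefix.exists_brick_subset ((hU₂.inter hU₃).mem_nhds ⟨hu₂, hu₃⟩)
  have hWs (κ) (hκ : κ ∈ (ψ.append α).brick) :
      κ ∈ V₁ ∩ V₃ ∩ (Prefix.single s b).brick := by
    obtain ⟨ζ, rfl⟩ := (Prefix.mem_brick _ _).1 hκ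
    rw [Prefix.canonical_append]
    exact (hα ζ).1
  have hRs (κ) (hκ : κ ∈ (φ.append (α.translate g)).brick) : κ ∈ U₁ ∩ V₂ := by
    obtain ⟨ζ, rfl⟩ := (Prefix.mem_brick _ _).1 hκ
    have := (hα (g⁻¹ • ζ)).2
    rw [Prefix.smul_canonical, smul_inv_smul] at this
    rwa [Prefix.canonical_append]
  have hMs (κ) (hκ : κ ∈ M.brick) : κ ∈ U₂ ∩ U₃ := by
    obtain ⟨ζ, rfl⟩ := (Prefix.mem_brick _ _).1 hκ
    exact hM ζ
  have h1 : (ψ.append α).Disj (φ.append (α.translate g)) := Set.disjoint_left.2 fun κ hκ hκ' =>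
    Set.disjoint_left.1 hd₁ (hRs κ hκ').1 (hWs κ hκ).1.1
  have h2 : (ψ.append α).Disj M := Set.disjoint_left.2 fun κ hκ hκ' =>
    Set.disjoint_left.1 hd₃ (hMs κ hκ').2 (hWs κ hκ).1.2
  have h3 : (φ.append (α.translate g)).Disj M := Set.disjoint_left.2 fun κ hκ hκ' =>
    Set.disjoint_left.1 hd₂ (hMs κ hκ').1 (hRs κ hκ).2
  have h4 : (ψ.append α).Disj (Prefix.single s !b) := Set.disjoint_left.2 fun κ hκ hκ' =>
    Set.disjoint_left.1 (disj_single_not s b) (hWs κ hκ).2 hκ'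
  let c : LocalPerm G S := ⁅copyHom (φ.append (α.translate g)) (root S g) *
    swap G (ψ.append α) (φ.append (α.translate g)), swap G (ψ.append α) M⁆
  -- The commutator `c` agrees with `e` on the small brick, so `c⁻¹ * e` fixes it pointwise.
  obtain ⟨x, y, u, v, h5⟩ := exists_commutators_of_fix h4 (e := c⁻¹ * e) fun y => by
    rw [mul_apply]
    refine inv_apply_eq ((commutatorElement_apply h1 h2 h3 g y).trans ?_)
    rw [Prefix.emb_append, Prefix.emb_append, h, Prefix.smul_emb]
  exact ⟨_, _, x, y, u, v, eq_mul_of_inv_mul_eq h5⟩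

/-- An element that moves no point of `C^S` can still be nontrivial, through labels that act
trivially on `S`. Multiplied by a commutator that moves a brick off itself, it moves a point. -/
theorem exists_eq_commutators [Nonempty S] (e : LocalPerm G S) :
    ∃ p q x y u v w z : LocalPerm G S, e = ⁅p, q⁆ * (⁅x, y⁆ * ⁅u, v⁆) * ⁅w, z⁆ := by
  have s : S := Classical.arbitrary S
  by_cases he : ∃ κ, (e.1 (κ, 1)).1 ≠ κ
  · obtain ⟨κ, hκ⟩ := he
    obtain ⟨p, q, x, y, u, v, h⟩ := exists_commutators_of_move hκ
    exact ⟨p, q, x, y, u, v, 1, 1, by simp [h]⟩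
  push Not at he
  have hs := Prefix.disj_single s
  let W : Prefix S := .single s false
  let R : Prefix S := (Prefix.single s true).append (.single s false)
  let M : Prefix S := (Prefix.single s true).append (.single s true)
  let c : LocalPerm G S := ⁅copyHom R (root S 1) * swap G W R, swap G W M⁆
  let z : Pt G S := (fun _ _ => false, 1)
  have hc : c.1 (W.emb G z) = R.emb G z := by
    have := commutatorElement_apply (hs.append_right (.single s false))
      (hs.append_right (.single s true)) (hs.append_same (.single s true)) (1 : G) z
    rwa [one_smul] at this
  have hec : ((e * c).1 ((W.emb G z).1, 1)).1 ≠ (W.emb G z).1 := by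
    have h1 : (e * c).1 ((W.emb G z).1, 1) = e.1 ((R.emb G z).1, 1) := congrArg e.1 hc
    rw [h1, he]
    intro h2
    exact (hs.append_right (.single s false)).emb_ne z z (Prod.ext h2.symm rfl)
  obtain ⟨p, q, x, y, u, v, h⟩ := exists_commutators_of_move hec
  refine ⟨p, q, x, y, u, v, swap G W M, copyHom R (root S 1) * swap G W R, ?_⟩
  rw [← h, ← commutatorElement_inv, mul_inv_cancel_right]

theorem isUniformlyPerfect [Nonempty S] : IsUniformlyPerfect 5 (LocalPerm G S) := by
  intro e
  obtain ⟨p, q, x, y, u, v, w, z, rfl⟩ := exists_eq_commutators e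
  -- Four commutators suffice; the fifth is trivial.
  refine ⟨![p, x, u, w, 1], ![q, y, v, z, 1], ?_⟩
  simp [List.ofFn_succ, commutatorElement_def, mul_assoc]

end LocalPerm

theorem IsUniformlyPerfect.of_mulEquiv {n : ℕ} {H K : Type*} [Group H] [Group K] (f : H ≃* K)
    (hK : IsUniformlyPerfect n K) : IsUniformlyPerfect n H := by
  intro h
  obtain ⟨a, b, hab⟩ := hK (f h)
  refine ⟨fun i => f.symm (a i), fun i => f.symm (b i), f.injective ?_⟩
  rw [hab, map_list_prod, List.map_ofFn]
  congr 2
  funext i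
  simp

end

end BrinThompson

theorem theorem6p2 {G : Type*} {S : Type*} [Group G] [MulAction G S] [Nonempty S] :
    BrinThompson.IsUniformlyPerfect 5 (BrinThompson.SV G S) :=
  .of_mulEquiv (MonoidHom.ofInjective BrinThompson.evalHom_injective)
    BrinThompson.LocalPerm.isUniformlyPerfect
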